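/- Let $\mathbb{T}_n$ be the space of real trigonometric polynomials of degree at most $n$, let $\|\cdot\|$ be the uniform norm on $\mathbb{R}$, and let $$\omega_4(f,t)=\sup_{0<h\le t}\ \sup_{x\in[-\pi,\pi]}\Bigl|\sum_{i=0}^4(-1)^{4-i}\binom 4i f(x-2h+ih)\Bigr|.$$ For $s\in\mathbb{N}$, $s\ge 1$, let $Y_s=\{y_i\}_{i\in\mathbb{Z}}$ be given by $2s$ points $-\pi\le y_{2s}<y_{2s-1}<\dots<y_1<\pi$, continued to all $i\in\mathbb{Z}$ by $y_i=y_{i+2s}+2\pi$, and put $\Pi(x,Y_s)=\prod_{i=1}^{2s}\sin\frac{x-y_i}{2}$. Let $\Delta^{(1)}(Y_s)$ be the set of continuous $2\pi$-periodic functions $f:\mathbb{R}\to\mathbb{R}$ that are nondecreasing on $[y_1,y_0]$, nonincreasing on $[y_2,y_1]$, nondecreasing on $[y_3,y_2]$, and so on (nondecreasing on $[y_i,y_{i-1}]$ for odd $i\in\mathbb{Z}$, nonincreasing for even $i\in\mathbb{Z}$). For $\epsilon\ge 0$ and $f\in\Delta^{(1)}(Y_s)$ let $$E_n^{(1)}(f,\epsilon,Y_s)=\inf\Bigl\{\|f-P\|:\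 P\in\mathbb{T}_n,\ \operatorname{meas}\bigl(\{x: P'(x)\,\Pi(x,Y_s)\ge 0\}\cap[-\pi,\pi]\bigr)\ge 2\pi-\epsilon\Bigr\}.$$ **Theorem 1.** For each $s\in\mathbb{N}$, $s\ge1$, and each sequence $\{\epsilon_n\}_{n=1}^\infty$ of nonnegative numbers tending to $0$, there exist a set $Y_s$, which can be taken to be the equidistant one, $y_i=\pi+\frac{\pi}{2s}-i\frac{\pi}{s}$ ($i\in\mathbb{Z}$), and a function $f\in\Delta^{(1)}(Y_s)$ such that $$\limsup_{n\to\infty}\frac{E_n^{(1)}(f,\epsilon_n,Y_s)}{\omega_4(f,\pi/n)}=\infty.$$ -/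

import Mathlib

open Filter MeasureTheory

noncomputable section

namespace Comonotone

/-- The uniform norm `‖f‖ = sup_{x ∈ ℝ} |f x|`. It is only used for differences of continuous
`2π`-periodic functions, for which the supremum is finite and attained. -/
def unifNorm (f : ℝ → ℝ) : ℝ := ⨆ x : ℝ, |f x|

/-- `P` is a real trigonometric polynomial of degree at most `n`, i.e. `P ∈ 𝕋_n`. -/
def IsTrigPoly (n : ℕ) (P : ℝ → ℝ) : Prop :=
  ∃ a b : ℕ → ℝ, ∀ x : ℝ,
    P x = a 0 + ∑ j ∈ Finset.Icc 1 n,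
      (a j * Real.cos ((j : ℝ) * x) + b j * Real.sin ((j : ℝ) * x))

/-- The `k`-th symmetric difference
`Δ_h^k f(x) = ∑_{i=0}^k (-1)^{k-i} (k choose i) f(x - (k/2) h + i h)`. -/
def centralDiff (k : ℕ) (h : ℝ) (f : ℝ → ℝ) (x : ℝ) : ℝ :=
  ∑ i ∈ Finset.range (k + 1),
    (-1 : ℝ) ^ (k - i) * (k.choose i : ℝ) * f (x - (k : ℝ) / 2 * h + (i : ℝ) * h)

/-- The `k`-th modulus of smoothness
`ω_k(f, t) = sup_{0 < h ≤ t} sup_{x ∈ [-π, π]} |Δ_h^k f(x)|`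
(used for bounded `f`). -/
def modulus (k : ℕ) (f : ℝ → ℝ) (t : ℝ) : ℝ :=
  sSup {d : ℝ | ∃ h x : ℝ, 0 < h ∧ h ≤ t ∧ x ∈ Set.Icc (-Real.pi) Real.pi ∧
    d = |centralDiff k h f x|}

/-- `y` is a family `Y_s = {y_i}_{i ∈ ℤ}`: there are `2s` points
`-π ≤ y_{2s} < y_{2s-1} < ⋯ < y_1 < π`, continued by `y_i = y_{i+2s} + 2π`. -/
structure IsNodes (s : ℕ) (y : ℤ → ℝ) : Prop where
  neg_pi_le : -Real.pi ≤ y (2 * (s : ℤ))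
  lt_pi : y 1 < Real.pi
  strict : ∀ i j : ℤ, 1 ≤ i → i < j → j ≤ 2 * (s : ℤ) → y j < y i
  shift : ∀ i : ℤ, y i = y (i + 2 * (s : ℤ)) + 2 * Real.pi

/-- `Π(x, Y_s) = ∏_{i=1}^{2s} sin ((x - y_i) / 2)`. -/
def nodeProd (s : ℕ) (y : ℤ → ℝ) (x : ℝ) : ℝ :=
  ∏ i ∈ Finset.Icc (1 : ℤ) (2 * (s : ℤ)), Real.sin ((x - y i) / 2)

/-- The class `Δ^{(1)}(Y_s)`: continuous `2π`-periodic functions, nondecreasing on `[y_1, y_0]`,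
nonincreasing on `[y_2, y_1]`, nondecreasing on `[y_3, y_2]`, and so on. -/
structure IsPiecewiseMonotone (y : ℤ → ℝ) (f : ℝ → ℝ) : Prop where
  continuous : Continuous f
  periodic : Function.Periodic f (2 * Real.pi)
  monotoneOn : ∀ i : ℤ, Odd i → MonotoneOn f (Set.Icc (y i) (y (i - 1)))
  antitoneOn : ∀ i : ℤ, Even i → AntitoneOn f (Set.Icc (y i) (y (i - 1)))

/-- The polynomials admitted in nearly comonotone approximation: `P ∈ 𝕋_n` with
`meas ({x : P'(x) Π(x, Y_s) ≥ 0} ∩ [-π, π]) ≥ 2π - ε`. -/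
def NearlyComonotone (s : ℕ) (y : ℤ → ℝ) (n : ℕ) (ε : ℝ) (P : ℝ → ℝ) : Prop :=
  IsTrigPoly n P ∧
    ENNReal.ofReal (2 * Real.pi - ε) ≤
      volume ({x : ℝ | 0 ≤ deriv P x * nodeProd s y x} ∩ Set.Icc (-Real.pi) Real.pi)

/-- `E_n^{(1)}(f, ε, Y_s) = inf ‖f - P‖` over the admitted `P ∈ 𝕋_n`. For `ε ≥ 0` constants are
admitted, so that the infimum is over a nonempty set of nonnegative numbers. -/
def nearlyComonotoneError (s : ℕ) (y : ℤ → ℝ) (n : ℕ) (ε : ℝ) (f : ℝ → ℝ) : ℝ :=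
  sInf {e : ℝ | ∃ P : ℝ → ℝ, NearlyComonotone s y n ε P ∧ e = unifNorm (fun x => f x - P x)}

end Comonotone

end

/-!
For a fixed degree `n` and a trigonometric polynomial `g` whose derivative has the wrong sign near some
point, a function `f` with the right monotonicity can be so close to `g` that every polynomial `P`
of degree `n` close to `f` inherits the wrong sign from `g`, by Bernstein's inequality for `P - g`
(`bernstein_inequality`). For `ω₄` the orders of magnitude allow this with any constant factor, in
the following way.

Let `F` be a trigonometric polynomial with `F' Π ≥ 0`. Multiply `F'` by a nonnegative trigonometric
polynomial `ρ (m x)` of mean one, where `ρ (u)` is proportional to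
`1 - cos u - 2 / q + (2 / q) ((1 + cos u) / 2) ^ q`, nonnegative by Bernoulli's inequality
(`rieszFactor_nonneg`). This gives `Φ'`; dropping the oscillation of the last term, whose mean is
only of order `q ^ (-3 / 2)` (`cosPowMean_sq_mul_le`), gives `g'`. Then `g' ≤ -c / q` on a set of
measure independent of `m` (`volume_near_grid_ge`), while `|Φ - g| ≤ C q ^ (-3 / 2) / m` and
`|g⁗| ≤ C m ^ 3` (`exists_perturbed_pair`). With `q = p ^ 8` and `n = p ^ 3 m`, every `f` in a small
ball around `Φ` has `ω₄(f, π / n) ≤ C p ^ (-12) / m`. If `|f - P| ≤ A ω₄(f, π / n)`, then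
`|P' - g'| ≤ C (A + 1) p ^ (-9)`, which for large `p` is less than `c p ^ (-8) ≤ |g'|`. So `P'` has
the wrong sign on a set whose measure does not depend on `m`, and exceeds `ε n` if `m` is large
(`exists_perturbation`).

Since `Φ` is again a trigonometric polynomial with `Φ' Π ≥ 0`, uniformly close to `F` for large `m`,
the step can be repeated inside ever smaller balls. The uniform limit `f`, whose derivative is
formally a Riesz product, is bad for infinitely many degrees (`exists_bad_function`). It remains
to see that `ω₄(f, π / n) ≠ 0`, as otherwise the quotient would be `0` by convention
(`modulus_four_pos`).
-/

namespace Comonotone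

/-! ### Spans of sines and cosines -/

/-- Real trigonometric polynomials with frequencies in `S`: the span of the functions `cos (j x)`
and `sin (j x)`, `j ∈ S`. The constants belong to it exactly when `0 ∈ S`. -/
noncomputable def trigSpan (S : Set ℤ) : Submodule ℝ (ℝ → ℝ) :=
  Submodule.span ℝ {u | ∃ j ∈ S, (u = fun x => Real.cos (j * x)) ∨ u = fun x => Real.sin (j * x)}

/-- Frequencies of the trigonometric polynomials of degree at most `n`. -/
def freq (n : ℕ) : Set ℤ := {j | |j| ≤ n}

/-- Frequencies of the trigonometric polynomials of degree at most `n` with mean zero. -/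
def freqNZ (n : ℕ) : Set ℤ := {j | j ≠ 0 ∧ |j| ≤ n}

theorem cos_mem_trigSpan {S : Set ℤ} {j : ℤ} (hj : j ∈ S) :
    (fun x : ℝ => Real.cos (j * x)) ∈ trigSpan S :=
  Submodule.subset_span ⟨j, hj, Or.inl rfl⟩

theorem sin_mem_trigSpan {S : Set ℤ} {j : ℤ} (hj : j ∈ S) :
    (fun x : ℝ => Real.sin (j * x)) ∈ trigSpan S :=
  Submodule.subset_span ⟨j, hj, Or.inr rfl⟩

theorem trigSpan_mono {S R : Set ℤ} (h : S ⊆ R) : trigSpan S ≤ trigSpan R :=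
  Submodule.span_mono fun _ ⟨j, hj, hu⟩ => ⟨j, h hj, hu⟩

theorem trigSpan_freq_mono {m n : ℕ} (h : m ≤ n) : trigSpan (freq m) ≤ trigSpan (freq n) :=
  trigSpan_mono fun j (hj : |j| ≤ m) => show |j| ≤ n by omega

theorem trigSpan_freqNZ_mono {m n : ℕ} (h : m ≤ n) : trigSpan (freqNZ m) ≤ trigSpan (freqNZ n) :=
  trigSpan_mono fun j hj => ⟨hj.1, by have := hj.2; omega⟩

theorem trigSpan_freqNZ_le (n : ℕ) : trigSpan (freqNZ n) ≤ trigSpan (freq n) :=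
  trigSpan_mono fun _ hj => hj.2

theorem const_mem_trigSpan {S : Set ℤ} (h : (0 : ℤ) ∈ S) (c : ℝ) :
    (fun _ : ℝ => c) ∈ trigSpan S := by
  have := (trigSpan S).smul_mem c (cos_mem_trigSpan h)
  convert this using 1
  ext x
  simp

theorem zero_mem_freq (n : ℕ) : (0 : ℤ) ∈ freq n := by simp [freq]

theorem trigSpan_induction {S : Set ℤ} {p : (ℝ → ℝ) → Prop}
    (hcos : ∀ j ∈ S, p fun x => Real.cos (j * x)) (hsin : ∀ j ∈ S, p fun x => Real.sin (j * x))
    (h0 : p 0) (hadd : ∀ u v, p u → p v → p (u + v)) (hsmul : ∀ (c : ℝ) u, p u → p (c • u))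
    {u : ℝ → ℝ} (hu : u ∈ trigSpan S) : p u := by
  refine Submodule.span_induction ?_ h0 (fun u v _ _ => hadd u v) (fun c u _ => hsmul c u) hu
  rintro _ ⟨j, hj, rfl | rfl⟩
  exacts [hcos j hj, hsin j hj]

theorem mul_mem_trigSpan {S S' R : Set ℤ} (h : ∀ a ∈ S, ∀ b ∈ S', a + b ∈ R ∧ a - b ∈ R)
    {u v : ℝ → ℝ} (hu : u ∈ trigSpan S) (hv : v ∈ trigSpan S') :
    u * v ∈ trigSpan R := by
  have key : ∀ (w : ℝ → ℝ) (a b c : ℝ → ℝ) (k : ℝ), a ∈ trigSpan R → b ∈ trigSpan R →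
      (∀ x, w x = 1 / 2 * a x + k * b x) → w ∈ trigSpan R := by
    intro w a b _ k ha hb hw
    have : w = (1 / 2 : ℝ) • a + k • b := by ext x; simp [hw]
    rw [this]
    exact add_mem (Submodule.smul_mem _ _ ha) (Submodule.smul_mem _ _ hb)
  refine trigSpan_induction (p := fun u => u * v ∈ trigSpan R) ?_ ?_ ?_ ?_ ?_ hu
  · intro a ha
    refine trigSpan_induction (p := fun v => (fun x => Real.cos (a * x)) * v ∈ trigSpan R)
      ?_ ?_ ?_ ?_ ?_ hv
    · intro b hb
      refine key _ _ _ 0 (1 / 2) (cos_mem_trigSpan (h a ha b hb).1)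
        (cos_mem_trigSpan (h a ha b hb).2) fun x => ?_
      simp only [Pi.mul_apply]
      push_cast
      rw [add_mul, sub_mul, Real.cos_add, Real.cos_sub]
      ring
    · intro b hb
      refine key _ _ _ 0 (-1 / 2) (sin_mem_trigSpan (h a ha b hb).1)
        (sin_mem_trigSpan (h a ha b hb).2) fun x => ?_
      simp only [Pi.mul_apply]
      push_cast
      rw [add_mul, sub_mul, Real.sin_add, Real.sin_sub]
      ring
    · simp
    · intro v w hv hw
      rw [mul_add]
      exact add_mem hv hw
    · intro c v hv
      rw [mul_smul_comm]
      exact Submodule.smul_mem _ _ hv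
  · intro a ha
    refine trigSpan_induction (p := fun v => (fun x => Real.sin (a * x)) * v ∈ trigSpan R)
      ?_ ?_ ?_ ?_ ?_ hv
    · intro b hb
      refine key _ _ _ 0 (1 / 2) (sin_mem_trigSpan (h a ha b hb).1)
        (sin_mem_trigSpan (h a ha b hb).2) fun x => ?_
      simp only [Pi.mul_apply]
      push_cast
      rw [add_mul, sub_mul, Real.sin_add, Real.sin_sub]
      ring
    · intro b hb
      have : (fun x : ℝ => Real.sin (a * x)) * (fun x => Real.sin (b * x)) =
          (-1 / 2 : ℝ) • (fun x => Real.cos ((a + b : ℤ) * x)) +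
            (1 / 2 : ℝ) • fun x => Real.cos ((a - b : ℤ) * x) := by
        ext x
        simp only [Pi.mul_apply, Pi.add_apply, Pi.smul_apply, smul_eq_mul]
        push_cast
        rw [add_mul, sub_mul, Real.cos_add, Real.cos_sub]
        ring
      rw [this]
      exact add_mem (Submodule.smul_mem _ _ (cos_mem_trigSpan (h a ha b hb).1))
        (Submodule.smul_mem _ _ (cos_mem_trigSpan (h a ha b hb).2))
    · simp
    · intro v w hv hw
      rw [mul_add]
      exact add_mem hv hw
    · intro c v hv
      rw [mul_smul_comm]
      exact Submodule.smul_mem _ _ hv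
  · simp
  · intro u w hu hw
    rw [add_mul]
    exact add_mem hu hw
  · intro c u hu
    rw [smul_mul_assoc]
    exact Submodule.smul_mem _ _ hu

theorem dilate_mem_trigSpan {S R : Set ℤ} {m : ℤ} (h : ∀ a ∈ S, a * m ∈ R)
    {u : ℝ → ℝ} (hu : u ∈ trigSpan S) : (fun x => u (m * x)) ∈ trigSpan R := by
  refine trigSpan_induction (p := fun u => (fun x => u (m * x)) ∈ trigSpan R) ?_ ?_ ?_ ?_ ?_ hu
  · intro a ha
    convert cos_mem_trigSpan (h a ha) using 3
    push_cast
    ring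
  · intro a ha
    convert sin_mem_trigSpan (h a ha) using 3
    push_cast
    ring
  · exact zero_mem _
  · intro u v hu hv
    exact add_mem hu hv
  · intro c u hu
    exact Submodule.smul_mem _ c hu

/-- Multiplication by a mean-zero polynomial of higher frequency `m` destroys the mean: no frequency
`l + j m` with `|l| < m`, `j ≠ 0` vanishes. -/
theorem mul_dilate_mem_trigSpan {d r m : ℕ} (hm : d < m) {u v : ℝ → ℝ}
    (hu : u ∈ trigSpan (freq d)) (hv : v ∈ trigSpan (freqNZ r)) :
    (fun x => u x * v (m * x)) ∈ trigSpan (freqNZ (d + r * m)) := by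
  have hv' : (fun x => v (m * x)) ∈ trigSpan {j : ℤ | (m : ℤ) ≤ |j| ∧ |j| ≤ r * m} := by
    have := dilate_mem_trigSpan (m := m) (R := {j : ℤ | (m : ℤ) ≤ |j| ∧ |j| ≤ r * m}) ?_ hv
    · simpa using this
    · rintro a ⟨ha, ha'⟩
      have h1 : (1 : ℤ) ≤ |a| := Int.one_le_abs ha
      simp only [Set.mem_ofPred_eq, abs_mul, Nat.abs_cast]
      constructor <;> nlinarith
  refine mul_mem_trigSpan ?_ hu hv'
  rintro a (ha : |a| ≤ d) b ⟨hb, hb'⟩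
  have ha1 := abs_le.1 ha
  have hb1 := abs_le.1 hb'
  have hb2 := le_abs.1 hb
  simp only [freqNZ, Set.mem_ofPred_eq]
  push_cast
  generalize (r : ℤ) * m = t at *
  refine ⟨⟨?_, abs_le.2 ?_⟩, ?_, abs_le.2 ?_⟩ <;> omega

theorem hasDerivAt_cos_mul (j x : ℝ) :
    HasDerivAt (fun x => Real.cos (j * x)) (-j * Real.sin (j * x)) x :=
  ((hasDerivAt_id x).const_mul j).cos.congr_deriv (by simp only [id]; ring)

theorem hasDerivAt_sin_mul (j x : ℝ) :
    HasDerivAt (fun x => Real.sin (j * x)) (j * Real.cos (j * x)) x :=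
  ((hasDerivAt_id x).const_mul j).sin.congr_deriv (by simp only [id]; ring)

theorem exists_deriv_mem_trigSpan {n : ℕ} {u : ℝ → ℝ} (hu : u ∈ trigSpan (freq n)) :
    ∃ u' ∈ trigSpan (freqNZ n), ∀ x, HasDerivAt u (u' x) x := by
  refine trigSpan_induction
    (p := fun u => ∃ u' ∈ trigSpan (freqNZ n), ∀ x, HasDerivAt u (u' x) x) ?_ ?_ ?_ ?_ ?_ hu
  · intro j hj
    rcases eq_or_ne j 0 with rfl | h0
    · exact ⟨0, zero_mem _, fun x => by simpa using hasDerivAt_const x (1 : ℝ)⟩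
    · refine ⟨(-j : ℝ) • fun x => Real.sin (j * x),
        Submodule.smul_mem _ _ (sin_mem_trigSpan ⟨h0, hj⟩), fun x => ?_⟩
      exact hasDerivAt_cos_mul j x
  · intro j hj
    rcases eq_or_ne j 0 with rfl | h0
    · exact ⟨0, zero_mem _, fun x => by simpa using hasDerivAt_const x (0 : ℝ)⟩
    · refine ⟨(j : ℝ) • fun x => Real.cos (j * x),
        Submodule.smul_mem _ _ (cos_mem_trigSpan ⟨h0, hj⟩), fun x => ?_⟩
      exact hasDerivAt_sin_mul j x
  · exact ⟨0, zero_mem _, fun x => hasDerivAt_const x (0 : ℝ)⟩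
  · rintro u v ⟨u', hu', hu⟩ ⟨v', hv', hv⟩
    exact ⟨u' + v', add_mem hu' hv', fun x => (hu x).add (hv x)⟩
  · rintro c u ⟨u', hu', hu⟩
    exact ⟨c • u', Submodule.smul_mem _ _ hu', fun x => (hu x).const_smul c⟩

theorem exists_primitive_mem_trigSpan {n : ℕ} {u : ℝ → ℝ} (hu : u ∈ trigSpan (freqNZ n)) :
    ∃ v ∈ trigSpan (freqNZ n), ∀ x, HasDerivAt v (u x) x := by
  refine trigSpan_induction
    (p := fun u => ∃ v ∈ trigSpan (freqNZ n), ∀ x, HasDerivAt v (u x) x) ?_ ?_ ?_ ?_ ?_ hu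
  · intro j hj
    have hj0 : (j : ℝ) ≠ 0 := by exact_mod_cast hj.1
    refine ⟨(1 / j : ℝ) • fun x => Real.sin (j * x),
      Submodule.smul_mem _ _ (sin_mem_trigSpan hj), fun x => ?_⟩
    exact ((hasDerivAt_sin_mul j x).const_mul (1 / j : ℝ)).congr_deriv (by field_simp)
  · intro j hj
    have hj0 : (j : ℝ) ≠ 0 := by exact_mod_cast hj.1
    refine ⟨(-1 / j : ℝ) • fun x => Real.cos (j * x),
      Submodule.smul_mem _ _ (cos_mem_trigSpan hj), fun x => ?_⟩
    exact ((hasDerivAt_cos_mul j x).const_mul (-1 / j : ℝ)).congr_deriv (by field_simp)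
  · exact ⟨0, zero_mem _, fun x => hasDerivAt_const x (0 : ℝ)⟩
  · rintro u v ⟨u', hu', hu⟩ ⟨v', hv', hv⟩
    exact ⟨u' + v', add_mem hu' hv', fun x => (hu x).add (hv x)⟩
  · rintro c u ⟨u', hu', hu⟩
    exact ⟨c • u', Submodule.smul_mem _ _ hu', fun x => (hu x).const_smul c⟩

theorem exists_bound_of_mem_trigSpan {S : Set ℤ} {u : ℝ → ℝ} (hu : u ∈ trigSpan S) :
    ∃ M, ∀ x, |u x| ≤ M := by
  refine trigSpan_induction (p := fun u => ∃ M, ∀ x, |u x| ≤ M) ?_ ?_ ?_ ?_ ?_ hu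
  · exact fun j _ => ⟨1, fun x => Real.abs_cos_le_one _⟩
  · exact fun j _ => ⟨1, fun x => Real.abs_sin_le_one _⟩
  · exact ⟨0, by simp⟩
  · rintro u v ⟨M, hM⟩ ⟨M', hM'⟩
    exact ⟨M + M', fun x => (abs_add_le _ _).trans (add_le_add (hM x) (hM' x))⟩
  · rintro c u ⟨M, hM⟩
    refine ⟨|c| * M, fun x => ?_⟩
    simpa [abs_mul] using mul_le_mul_of_nonneg_left (hM x) (abs_nonneg c)

theorem periodic_of_mem_trigSpan {S : Set ℤ} {u : ℝ → ℝ} (hu : u ∈ trigSpan S) :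
    Function.Periodic u (2 * Real.pi) := by
  refine trigSpan_induction (p := fun u => Function.Periodic u (2 * Real.pi)) ?_ ?_ ?_ ?_ ?_ hu
  · intro j _ x
    simp only [mul_add]
    exact Real.cos_add_int_mul_two_pi _ _
  · intro j _ x
    simp only [mul_add]
    exact Real.sin_add_int_mul_two_pi _ _
  · exact fun x => rfl
  · exact fun u v hu hv => hu.add hv
  · intro c u hu x
    simp [hu x]

theorem IsTrigPoly.mem_trigSpan {n : ℕ} {P : ℝ → ℝ} (hP : IsTrigPoly n P) :
    P ∈ trigSpan (freq n) := by
  obtain ⟨a, b, h⟩ := hP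
  have : P = (fun _ => a 0) + ∑ j ∈ Finset.Icc 1 n,
      (a j • (fun x => Real.cos ((j : ℤ) * x)) + b j • fun x => Real.sin ((j : ℤ) * x)) := by
    ext x
    simp [h x, Finset.sum_apply]
  rw [this]
  refine add_mem (const_mem_trigSpan (zero_mem_freq n) _) (Submodule.sum_mem _ fun j hj => ?_)
  have hj' : (j : ℤ) ∈ freq n := by
    have := (Finset.mem_Icc.1 hj).2
    simpa [freq] using this
  exact add_mem (Submodule.smul_mem _ _ (cos_mem_trigSpan hj'))
    (Submodule.smul_mem _ _ (sin_mem_trigSpan hj'))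

/-! ### Bernstein's inequality, by the Fejér kernel on a grid -/

/-- The `k`-th of `N` equidistant points of the period. -/
noncomputable def gridPoint (N k : ℕ) : ℝ := 2 * Real.pi * k / N

theorem sum_exp_gridPoint {N : ℕ} (hN : 0 < N) {R : ℤ} (hR : ¬ (N : ℤ) ∣ R) :
    ∑ k ∈ Finset.range N, Complex.exp ((R * gridPoint N k : ℝ) * Complex.I) = 0 := by
  have hN' : (N : ℂ) ≠ 0 := by exact_mod_cast hN.ne'
  set z : ℂ := Complex.exp (R * (2 * Real.pi * Complex.I) / N) with hz
  have h1 : ∀ k ∈ Finset.range N,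
      Complex.exp ((R * gridPoint N k : ℝ) * Complex.I) = z ^ k := by
    intro k _
    rw [hz, ← Complex.exp_nat_mul]
    congr 1
    simp only [gridPoint]
    push_cast
    ring
  have hz1 : z ≠ 1 := by
    intro h
    obtain ⟨l, hl⟩ := Complex.exp_eq_one_iff.1 h
    apply hR
    have h3 : (R : ℂ) = l * N := by
      field_simp at hl
      linear_combination hl
    exact ⟨l, by rw [mul_comm]; exact_mod_cast h3⟩
  have hzN : z ^ N = 1 := by
    rw [hz, ← Complex.exp_nat_mul, Complex.exp_eq_one_iff]
    exact ⟨R, by field_simp⟩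
  rw [Finset.sum_congr rfl h1, geom_sum_eq hz1, hzN]
  simp

theorem sum_cos_gridPoint {N : ℕ} (hN : 0 < N) {R : ℤ} (hR : ¬ (N : ℤ) ∣ R) :
    ∑ k ∈ Finset.range N, Real.cos (R * gridPoint N k) = 0 := by
  have h := congrArg Complex.re (sum_exp_gridPoint hN hR)
  rw [Complex.re_sum] at h
  simpa only [Complex.exp_ofReal_mul_I_re, Complex.zero_re] using h

theorem sum_sin_gridPoint {N : ℕ} (hN : 0 < N) (R : ℤ) :
    ∑ k ∈ Finset.range N, Real.sin (R * gridPoint N k) = 0 := by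
  by_cases hR : (N : ℤ) ∣ R
  · obtain ⟨l, rfl⟩ := hR
    refine Finset.sum_eq_zero fun k _ => ?_
    have hN' : (N : ℝ) ≠ 0 := by exact_mod_cast hN.ne'
    have : ((N * l : ℤ) : ℝ) * gridPoint N k = (2 * (l * k) : ℤ) * Real.pi := by
      simp only [gridPoint]
      push_cast
      field_simp
    rw [this, Real.sin_int_mul_pi]
  · have h := congrArg Complex.im (sum_exp_gridPoint hN hR)
    rw [Complex.im_sum] at h
    simpa only [Complex.exp_ofReal_mul_I_im, Complex.zero_im] using h

/-- Only small frequencies are considered, so that no aliasing occurs on the grid. -/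
theorem sum_cos_gridPoint_ite {N : ℕ} (hN : 0 < N) {R : ℤ} (hR : |R| < N) :
    ∑ k ∈ Finset.range N, Real.cos (R * gridPoint N k) = if R = 0 then (N : ℝ) else 0 := by
  split_ifs with h
  · simp [h]
  · exact sum_cos_gridPoint hN fun hd => h (Int.eq_zero_of_abs_lt_dvd hd hR)

/-- `n` times the Fejér kernel of order `n`, as a sum over pairs of frequencies. -/
noncomputable def fejer (n : ℕ) (t : ℝ) : ℝ :=
  ∑ a ∈ Finset.range n, ∑ b ∈ Finset.range n, Real.cos (((a : ℤ) - (b : ℤ) : ℤ) * t)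

theorem fejer_nonneg (n : ℕ) (t : ℝ) : 0 ≤ fejer n t := by
  have : fejer n t = (∑ a ∈ Finset.range n, Real.cos (a * t)) ^ 2 +
      (∑ a ∈ Finset.range n, Real.sin (a * t)) ^ 2 := by
    rw [sq, sq, Finset.sum_mul_sum, Finset.sum_mul_sum, fejer, ← Finset.sum_add_distrib]
    refine Finset.sum_congr rfl fun a _ => ?_
    rw [← Finset.sum_add_distrib]
    refine Finset.sum_congr rfl fun b _ => ?_
    push_cast
    rw [sub_mul, Real.cos_sub]
  rw [this]
  positivity

/-- The weights of a quadrature formula for the derivative of trigonometric polynomials of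
degree at most `n`. -/
noncomputable def derivWeight (n k : ℕ) : ℝ :=
  2 / (3 * n : ℕ) * (Real.sin (n * gridPoint (3 * n) k) * fejer n (gridPoint (3 * n) k))

theorem sum_abs_derivWeight_le {n : ℕ} (hn : 1 ≤ n) :
    ∑ k ∈ Finset.range (3 * n), |derivWeight n k| ≤ 2 * n := by
  have hN : 0 < 3 * n := by omega
  have hN' : ((3 * n : ℕ) : ℝ) ≠ 0 := by exact_mod_cast hN.ne'
  have h1 : ∑ k ∈ Finset.range (3 * n), fejer n (gridPoint (3 * n) k) = n * (3 * n : ℕ) := by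
    simp only [fejer]
    rw [Finset.sum_comm]
    have : ∀ a ∈ Finset.range n, ∑ k ∈ Finset.range (3 * n), ∑ b ∈ Finset.range n,
        Real.cos (((a : ℤ) - (b : ℤ) : ℤ) * gridPoint (3 * n) k) = (3 * n : ℕ) := by
      intro a ha
      rw [Finset.sum_comm]
      have h : ∀ b ∈ Finset.range n, ∑ k ∈ Finset.range (3 * n),
          Real.cos (((a : ℤ) - (b : ℤ) : ℤ) * gridPoint (3 * n) k) =
          if a = b then ((3 * n : ℕ) : ℝ) else 0 := by
        intro b hb
        rw [Finset.mem_range] at ha hb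
        rw [sum_cos_gridPoint_ite hN (by rw [abs_lt]; push_cast; omega)]
        simp only [sub_eq_zero, Nat.cast_inj]
      rw [Finset.sum_congr rfl h, Finset.sum_ite_eq, if_pos ha]
    rw [Finset.sum_congr rfl this]
    simp
  calc ∑ k ∈ Finset.range (3 * n), |derivWeight n k|
      ≤ ∑ k ∈ Finset.range (3 * n), 2 / (3 * n : ℕ) * fejer n (gridPoint (3 * n) k) := by
        refine Finset.sum_le_sum fun k _ => ?_
        rw [derivWeight, abs_mul, abs_mul, abs_of_nonneg (fejer_nonneg _ _),
          abs_of_nonneg (by positivity : (0 : ℝ) ≤ 2 / (3 * n : ℕ))]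
        refine mul_le_mul_of_nonneg_left ?_ (by positivity)
        exact mul_le_of_le_one_left (fejer_nonneg _ _) (Real.abs_sin_le_one _)
    _ = 2 * n := by
        rw [← Finset.mul_sum, h1]
        field_simp

theorem sum_derivWeight_mul_cos {n : ℕ} (hn : 1 ≤ n) (j : ℤ) :
    ∑ k ∈ Finset.range (3 * n), derivWeight n k * Real.cos (j * gridPoint (3 * n) k) = 0 := by
  have hN : 0 < 3 * n := by omega
  have h : ∀ k ∈ Finset.range (3 * n),
      derivWeight n k * Real.cos (j * gridPoint (3 * n) k) =
      2 / (3 * n : ℕ) * ∑ a ∈ Finset.range n, ∑ b ∈ Finset.range n, 1 / 4 *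
        (Real.sin ((n + j + (a - b) : ℤ) * gridPoint (3 * n) k) +
         Real.sin ((n + j - (a - b) : ℤ) * gridPoint (3 * n) k) +
         Real.sin ((n - j + (a - b) : ℤ) * gridPoint (3 * n) k) +
         Real.sin ((n - j - (a - b) : ℤ) * gridPoint (3 * n) k)) := by
    intro k _
    rw [derivWeight, fejer, mul_assoc]
    congr 1
    rw [Finset.mul_sum, Finset.sum_mul]
    refine Finset.sum_congr rfl fun a _ => ?_
    rw [Finset.mul_sum, Finset.sum_mul]
    refine Finset.sum_congr rfl fun b _ => ?_
    push_cast
    generalize gridPoint (3 * n) k = t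
    generalize (a : ℝ) - b = c
    simp only [add_mul, sub_mul, Real.sin_add, Real.sin_sub, Real.cos_add, Real.cos_sub]
    ring
  rw [Finset.sum_congr rfl h, ← Finset.mul_sum, Finset.sum_comm]
  refine mul_eq_zero_of_right _ (Finset.sum_eq_zero fun a _ => ?_)
  rw [Finset.sum_comm]
  refine Finset.sum_eq_zero fun b _ => ?_
  rw [← Finset.mul_sum]
  simp only [Finset.sum_add_distrib, sum_sin_gridPoint hN]
  simp

theorem sum_derivWeight_mul_sin_nat {n : ℕ} (hn : 1 ≤ n) {j : ℕ} (hj : j ≤ n) :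
    ∑ k ∈ Finset.range (3 * n), derivWeight n k * Real.sin (j * gridPoint (3 * n) k) = j := by
  rcases Nat.eq_zero_or_pos j with rfl | hj0
  · simp
  have hN : 0 < 3 * n := by omega
  have hN' : ((3 * n : ℕ) : ℝ) ≠ 0 := by exact_mod_cast hN.ne'
  have h : ∀ k ∈ Finset.range (3 * n),
      derivWeight n k * Real.sin (j * gridPoint (3 * n) k) =
      2 / (3 * n : ℕ) * ∑ a ∈ Finset.range n, ∑ b ∈ Finset.range n, 1 / 4 *
        (Real.cos ((n - j + (a - b) : ℤ) * gridPoint (3 * n) k) +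
         Real.cos ((n - j - (a - b) : ℤ) * gridPoint (3 * n) k) -
         Real.cos ((n + j + (a - b) : ℤ) * gridPoint (3 * n) k) -
         Real.cos ((n + j - (a - b) : ℤ) * gridPoint (3 * n) k)) := by
    intro k _
    rw [derivWeight, fejer, mul_assoc]
    congr 1
    rw [Finset.mul_sum, Finset.sum_mul]
    refine Finset.sum_congr rfl fun a _ => ?_
    rw [Finset.mul_sum, Finset.sum_mul]
    refine Finset.sum_congr rfl fun b _ => ?_
    push_cast
    generalize gridPoint (3 * n) k = t
    generalize (a : ℝ) - b = c
    simp only [add_mul, sub_mul, Real.sin_add, Real.sin_sub, Real.cos_add, Real.cos_sub]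
    ring
  -- `b = a + (n - j)` has exactly `j` solutions in `[0, n)²`
  have hcount : ∑ a ∈ Finset.range n, ∑ b ∈ Finset.range n,
      (if a + (n - j) = b then (1 : ℝ) else 0) = j := by
    have : ∀ a ∈ Finset.range n, ∑ b ∈ Finset.range n,
        (if a + (n - j) = b then (1 : ℝ) else 0) = if a < j then 1 else 0 := by
      intro a _
      rw [Finset.sum_ite_eq]
      refine if_congr ?_ rfl rfl
      rw [Finset.mem_range]
      omega
    rw [Finset.sum_congr rfl this, ← Finset.sum_filter, Finset.sum_const, nsmul_eq_mul, mul_one]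
    congr 1
    have : Finset.filter (fun a => a < j) (Finset.range n) = Finset.range j := by
      ext a
      simp only [Finset.mem_filter, Finset.mem_range]
      omega
    rw [this, Finset.card_range]
  have hcount' : ∑ a ∈ Finset.range n, ∑ b ∈ Finset.range n,
      (if b + (n - j) = a then (1 : ℝ) else 0) = j := by
    rw [Finset.sum_comm, hcount]
  rw [Finset.sum_congr rfl h, ← Finset.mul_sum, Finset.sum_comm]
  have h2 : ∀ a ∈ Finset.range n, ∑ k ∈ Finset.range (3 * n), ∑ b ∈ Finset.range n, 1 / 4 *
        (Real.cos ((n - j + (a - b) : ℤ) * gridPoint (3 * n) k) +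
         Real.cos ((n - j - (a - b) : ℤ) * gridPoint (3 * n) k) -
         Real.cos ((n + j + (a - b) : ℤ) * gridPoint (3 * n) k) -
         Real.cos ((n + j - (a - b) : ℤ) * gridPoint (3 * n) k)) =
      ∑ b ∈ Finset.range n, 1 / 4 * (3 * n : ℕ) *
        ((if a + (n - j) = b then (1 : ℝ) else 0) + if b + (n - j) = a then (1 : ℝ) else 0) := by
    intro a ha
    rw [Finset.sum_comm]
    refine Finset.sum_congr rfl fun b hb => ?_
    rw [Finset.mem_range] at ha hb
    rw [← Finset.mul_sum]
    simp only [Finset.sum_add_distrib, Finset.sum_sub_distrib]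
    rw [sum_cos_gridPoint_ite hN (by rw [abs_lt]; push_cast; omega),
      sum_cos_gridPoint_ite hN (by rw [abs_lt]; push_cast; omega),
      sum_cos_gridPoint_ite hN (by rw [abs_lt]; push_cast; omega),
      sum_cos_gridPoint_ite hN (by rw [abs_lt]; push_cast; omega),
      if_neg (show ¬ (n + j + (a - b) : ℤ) = 0 by omega),
      if_neg (show ¬ (n + j - (a - b) : ℤ) = 0 by omega),
      if_congr (show (n - j + (a - b) : ℤ) = 0 ↔ a + (n - j) = b by omega) rfl rfl,
      if_congr (show (n - j - (a - b) : ℤ) = 0 ↔ b + (n - j) = a by omega) rfl rfl]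
    split_ifs <;> ring
  rw [Finset.sum_congr rfl h2]
  simp only [← Finset.mul_sum, Finset.sum_add_distrib]
  rw [hcount, hcount']
  field_simp
  ring

theorem sum_derivWeight_mul_sin {n : ℕ} (hn : 1 ≤ n) {j : ℤ} (hj : |j| ≤ n) :
    ∑ k ∈ Finset.range (3 * n), derivWeight n k * Real.sin (j * gridPoint (3 * n) k) = j := by
  rcases Int.eq_nat_or_neg j with ⟨i, rfl | rfl⟩
  · exact_mod_cast sum_derivWeight_mul_sin_nat hn (j := i) (by simpa using hj)
  · push_cast
    simp only [neg_mul, Real.sin_neg, mul_neg, Finset.sum_neg_distrib]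
    rw [sum_derivWeight_mul_sin_nat hn (by simpa using hj)]

theorem hasDerivAt_of_mem_trigSpan {n : ℕ} (hn : 1 ≤ n) {u : ℝ → ℝ}
    (hu : u ∈ trigSpan (freq n)) (x : ℝ) :
    HasDerivAt u (∑ k ∈ Finset.range (3 * n), derivWeight n k * u (x + gridPoint (3 * n) k)) x := by
  refine trigSpan_induction (p := fun u => ∀ x, HasDerivAt u
    (∑ k ∈ Finset.range (3 * n), derivWeight n k * u (x + gridPoint (3 * n) k)) x)
    ?_ ?_ ?_ ?_ ?_ hu x
  · intro j hj x
    refine (hasDerivAt_cos_mul j x).congr_deriv ?_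
    have : ∀ k ∈ Finset.range (3 * n),
        derivWeight n k * Real.cos (j * (x + gridPoint (3 * n) k)) =
        Real.cos (j * x) * (derivWeight n k * Real.cos (j * gridPoint (3 * n) k)) -
        Real.sin (j * x) * (derivWeight n k * Real.sin (j * gridPoint (3 * n) k)) := by
      intro k _
      rw [mul_add, Real.cos_add]
      ring
    rw [Finset.sum_congr rfl this, Finset.sum_sub_distrib, ← Finset.mul_sum, ← Finset.mul_sum,
      sum_derivWeight_mul_cos hn, sum_derivWeight_mul_sin hn hj]
    ring
  · intro j hj x
    refine (hasDerivAt_sin_mul j x).congr_deriv ?_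
    have : ∀ k ∈ Finset.range (3 * n),
        derivWeight n k * Real.sin (j * (x + gridPoint (3 * n) k)) =
        Real.sin (j * x) * (derivWeight n k * Real.cos (j * gridPoint (3 * n) k)) +
        Real.cos (j * x) * (derivWeight n k * Real.sin (j * gridPoint (3 * n) k)) := by
      intro k _
      rw [mul_add, Real.sin_add]
      ring
    rw [Finset.sum_congr rfl this, Finset.sum_add_distrib, ← Finset.mul_sum, ← Finset.mul_sum,
      sum_derivWeight_mul_cos hn, sum_derivWeight_mul_sin hn hj]
    ring
  · intro x
    simp [hasDerivAt_zero]
  · intro u v hu hv x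
    refine ((hu x).add (hv x)).congr_deriv ?_
    simp [mul_add, Finset.sum_add_distrib]
  · intro c u hu x
    refine ((hu x).const_smul c).congr_deriv ?_
    simp only [Pi.smul_apply, smul_eq_mul, Finset.mul_sum]
    exact Finset.sum_congr rfl fun k _ => by ring

/-- Bernstein's inequality, with the constant `2` instead of the optimal `1`. -/
theorem bernstein_inequality {n : ℕ} (hn : 1 ≤ n) {u u' : ℝ → ℝ} (hu : u ∈ trigSpan (freq n))
    (hd : ∀ x, HasDerivAt u (u' x) x) {M : ℝ} (hM : ∀ x, |u x| ≤ M) (x : ℝ) :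
    |u' x| ≤ 2 * n * M := by
  have hM0 : 0 ≤ M := (abs_nonneg _).trans (hM 0)
  rw [(hd x).unique (hasDerivAt_of_mem_trigSpan hn hu x)]
  calc _ ≤ ∑ k ∈ Finset.range (3 * n), |derivWeight n k * u (x + gridPoint (3 * n) k)| :=
        Finset.abs_sum_le_sum_abs _ _
    _ ≤ ∑ k ∈ Finset.range (3 * n), |derivWeight n k| * M := by
        refine Finset.sum_le_sum fun k _ => ?_
        rw [abs_mul]
        exact mul_le_mul_of_nonneg_left (hM _) (abs_nonneg _)
    _ ≤ 2 * n * M := by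
        rw [← Finset.sum_mul]
        exact mul_le_mul_of_nonneg_right (sum_abs_derivWeight_le hn) hM0

/-! ### Powers of `(1 + cos u) / 2` -/

/-- The mean value of `((1 + cos u) / 2) ^ q`, namely `(2q choose q) / 4 ^ q`, given by its
recursion. -/
noncomputable def cosPowMean : ℕ → ℝ
  | 0 => 1
  | q + 1 => cosPowMean q * ((2 * q + 1) / (2 * q + 2))

theorem cosPowMean_pos (q : ℕ) : 0 < cosPowMean q := by
  induction q with
  | zero => simp [cosPowMean]
  | succ q ih =>
    rw [cosPowMean]
    positivity

theorem cosPowMean_sq_mul_le (q : ℕ) : cosPowMean q ^ 2 * (2 * q + 1) ≤ 1 := by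
  induction q with
  | zero => simp [cosPowMean]
  | succ q ih =>
    rw [cosPowMean]
    push_cast
    have hq : (0 : ℝ) ≤ q := q.cast_nonneg
    have h : (cosPowMean q * ((2 * q + 1) / (2 * q + 2))) ^ 2 * (2 * ((q : ℝ) + 1) + 1) =
        cosPowMean q ^ 2 * (2 * q + 1) * ((2 * q + 1) * (2 * q + 3) / (2 * q + 2) ^ 2) := by
      field_simp
      ring
    rw [h]
    refine mul_le_one₀ ih (by positivity) ?_
    rw [div_le_one (by positivity)]
    nlinarith

theorem cosPowMean_pow_eight_le {p : ℕ} (hp : 1 ≤ p) : cosPowMean (p ^ 8) * p ^ 4 ≤ 1 := by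
  have h := cosPowMean_sq_mul_le (p ^ 8)
  have h0 := cosPowMean_pos (p ^ 8)
  have hp0 : (0 : ℝ) < p := by exact_mod_cast hp
  push_cast at h
  refine (sq_le_one_iff₀ (by positivity)).1 ?_
  calc (cosPowMean (p ^ 8) * p ^ 4) ^ 2 = cosPowMean (p ^ 8) ^ 2 * p ^ 8 := by ring
    _ ≤ cosPowMean (p ^ 8) ^ 2 * (2 * p ^ 8 + 1) := by
        refine mul_le_mul_of_nonneg_left ?_ (by positivity)
        nlinarith [pow_pos hp0 8]
    _ ≤ 1 := h

theorem cosPowMean_le_half {q : ℕ} (hq : 2 ≤ q) : cosPowMean q ≤ 1 / 2 := by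
  have h := cosPowMean_sq_mul_le q
  have h0 := cosPowMean_pos q
  have hq' : (2 : ℝ) ≤ q := by exact_mod_cast hq
  by_contra hc
  push Not at hc
  nlinarith [mul_self_nonneg (cosPowMean q - 1 / 2), mul_pos h0 h0]

/-- The identity behind the induction is `(sin u * c ^ q)' = (2q + 2) c ^ (q + 1) - (2q + 1) c ^ q`
for `c = (1 + cos u) / 2`. -/
theorem cosPow_sub_mean_mem (q : ℕ) :
    (fun u => ((1 + Real.cos u) / 2) ^ q - cosPowMean q) ∈ trigSpan (freqNZ q) := by
  have hcos : ∀ {n : ℕ}, 1 ≤ n → Real.cos ∈ trigSpan (freq n) := by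
    intro n hn
    simpa using cos_mem_trigSpan (S := freq n) (j := 1) (by simp [freq]; omega)
  have hsin : Real.sin ∈ trigSpan (freq 1) := by
    simpa using sin_mem_trigSpan (S := freq 1) (j := 1) (by simp [freq])
  have hadd : ∀ a b : ℕ, ∀ i ∈ freq a, ∀ j ∈ freq b, i + j ∈ freq (a + b) ∧ i - j ∈ freq (a + b) := by
    rintro a b i (hi : |i| ≤ a) j (hj : |j| ≤ b)
    simp only [freq, Set.mem_ofPred_eq, abs_le] at *
    push_cast
    omega
  have hpow : ∀ q : ℕ, (fun u => ((1 + Real.cos u) / 2) ^ q) ∈ trigSpan (freq q) := by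
    intro q
    induction q with
    | zero => simpa using const_mem_trigSpan (zero_mem_freq 0) 1
    | succ q ih =>
      have h1 : (fun u => (1 + Real.cos u) / 2) ∈ trigSpan (freq 1) := by
        have := add_mem (const_mem_trigSpan (zero_mem_freq 1) (1 / 2))
          ((trigSpan (freq 1)).smul_mem (1 / 2) (hcos le_rfl))
        convert this using 1
        ext u
        simp only [Pi.add_apply, Pi.smul_apply, smul_eq_mul]
        ring
      simp only [pow_succ]
      exact mul_mem_trigSpan (hadd q 1) ih h1
  induction q with
  | zero =>
    have : (fun u => ((1 + Real.cos u) / 2) ^ 0 - cosPowMean 0) = (0 : ℝ → ℝ) := by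
      ext u
      simp [cosPowMean]
    exact this ▸ zero_mem _
  | succ q ih =>
    have h1 : (fun u => Real.sin u * ((1 + Real.cos u) / 2) ^ q) ∈ trigSpan (freq (1 + q)) :=
      mul_mem_trigSpan (hadd 1 q) hsin (hpow q)
    rw [add_comm 1 q] at h1
    obtain ⟨w, hw, hd⟩ := exists_deriv_mem_trigSpan h1
    have hw' : ∀ u, w u = (2 * q + 2) * ((1 + Real.cos u) / 2) ^ (q + 1) -
        (2 * q + 1) * ((1 + Real.cos u) / 2) ^ q := by
      intro u
      refine (hd u).unique ?_
      have h2 : HasDerivAt (fun u => (1 + Real.cos u) / 2) (-Real.sin u / 2) u :=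
        ((Real.hasDerivAt_cos u).const_add 1).div_const 2
      refine ((Real.hasDerivAt_sin u).mul (h2.pow q)).congr_deriv ?_
      have hs : Real.sin u ^ 2 = 1 - Real.cos u ^ 2 := Real.sin_sq u
      rcases q with _ | q
      · simp
        ring
      · simp only [Nat.add_sub_cancel, Pi.pow_apply]
        push_cast
        ring_nf
        rw [hs]
        ring
    have h3 := add_mem
      ((trigSpan (freqNZ (q + 1))).smul_mem ((2 * q + 1) / (2 * q + 2) : ℝ)
        (trigSpan_freqNZ_mono (Nat.le_succ q) ih))
      ((trigSpan (freqNZ (q + 1))).smul_mem (1 / (2 * q + 2) : ℝ) hw)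
    convert h3 using 1
    ext u
    simp only [Pi.add_apply, Pi.smul_apply, smul_eq_mul, hw', cosPowMean]
    field_simp
    ring

/-- A mean-zero primitive differs little from its value at `0`: `∫₀ˣ c ^ q` grows from `0` to
`2π * cosPowMean q` over a period, and so does `cosPowMean q * x`. -/
theorem abs_primitive_cosPow_sub_le {q : ℕ} {v : ℝ → ℝ} (hv : Function.Periodic v (2 * Real.pi))
    (hd : ∀ u, HasDerivAt v (((1 + Real.cos u) / 2) ^ q - cosPowMean q) u) (u : ℝ) :
    |v u - v 0| ≤ 2 * Real.pi * cosPowMean q := by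
  obtain ⟨y, ⟨hy0, hy1⟩, hy⟩ := hv.exists_mem_Ico₀ Real.two_pi_pos u
  rw [hy]
  have hmono : Monotone fun u => v u + cosPowMean q * u := by
    refine monotone_of_hasDerivAt_nonneg (f' := fun u => ((1 + Real.cos u) / 2) ^ q)
      (fun u => ((hd u).add ((hasDerivAt_id u).const_mul _)).congr_deriv (by ring)) fun u => ?_
    have := Real.neg_one_le_cos u
    exact pow_nonneg (by linarith) q
  have h0 := hmono hy0
  have h1 := hmono hy1.le
  have h2 : v (2 * Real.pi) = v 0 := by simpa using hv 0
  simp only [h2] at h0 h1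
  have hp := cosPowMean_pos q
  have h3 : cosPowMean q * y ≤ cosPowMean q * (2 * Real.pi) :=
    mul_le_mul_of_nonneg_left hy1.le hp.le
  have h4 : 0 ≤ cosPowMean q * y := mul_nonneg hp.le hy0
  rw [abs_le]
  constructor <;> linarith

/-! ### Primitives of oscillating functions -/

/-- An oscillating density has a small primitive: integrate `u * h' (m ·)` by parts. -/
theorem abs_le_of_hasDerivAt_mul_dilate {u u' h h' V : ℝ → ℝ} {m M M' η : ℝ} (hm : 0 < m)
    (hu : ∀ x, HasDerivAt u (u' x) x) (hh : ∀ x, HasDerivAt h (h' x) x)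
    (hV : ∀ x, HasDerivAt V (u x * h' (m * x)) x) (hVper : Function.Periodic V (2 * Real.pi))
    (hV0 : V 0 = 0) (hM : ∀ x, |u x| ≤ M) (hM' : ∀ x, |u' x| ≤ M') (hη : ∀ x, |h x| ≤ η) (x : ℝ) :
    |V x| ≤ (2 * M + 7 * M') * η / m := by
  obtain ⟨y, ⟨hy0, hy1⟩, hy⟩ := hVper.exists_mem_Ico₀ Real.two_pi_pos x
  rw [hy]
  have hη0 : 0 ≤ η := (abs_nonneg _).trans (hη 0)
  have hM0' : 0 ≤ M' := (abs_nonneg _).trans (hM' 0)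
  have hd : ∀ x, HasDerivAt (fun x => V x - u x * h (m * x) / m) (-(u' x * h (m * x) / m)) x := by
    intro x
    have h1 : HasDerivAt (fun x => h (m * x)) (h' (m * x) * m) x := by
      refine ((hh (m * x)).comp x ((hasDerivAt_id x).const_mul m)).congr_deriv ?_
      simp
    refine ((hV x).sub (((hu x).mul h1).div_const m)).congr_deriv ?_
    field_simp
    ring
  have hb : ∀ x, ‖-(u' x * h (m * x) / m)‖ ≤ M' * η / m := by
    intro x
    rw [norm_neg, Real.norm_eq_abs, abs_div, abs_mul, abs_of_pos hm]
    gcongr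
    exacts [hM' x, hη _]
  have hmv := Convex.norm_image_sub_le_of_norm_hasDerivWithin_le (s := Set.univ)
    (fun x _ => (hd x).hasDerivWithinAt) (fun x _ => hb x) convex_univ
    (Set.mem_univ 0) (Set.mem_univ y)
  rw [Real.norm_eq_abs, Real.norm_eq_abs, sub_zero, abs_of_nonneg hy0, hV0] at hmv
  have hbd : ∀ x, |u x * h (m * x) / m| ≤ M * η / m := by
    intro x
    rw [abs_div, abs_mul, abs_of_pos hm]
    gcongr
    exacts [(abs_nonneg _).trans (hM 0), hM x, hη _]
  have h1 := abs_le.1 (hbd y)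
  have h2 := abs_le.1 (hbd 0)
  have h3 : M' * η / m * y ≤ M' * η / m * 7 := by
    refine mul_le_mul_of_nonneg_left ?_ (by positivity)
    linarith [Real.pi_lt_d2]
  have h4 := abs_le.1 (hmv.trans h3)
  have h5 : (2 * M + 7 * M') * η / m = 2 * (M * η / m) + M' * η / m * 7 := by ring
  rw [h5, abs_le]
  constructor <;> linarith [h1.1, h1.2, h2.1, h2.2, h4.1, h4.2]

/-! ### Differences and the modulus of smoothness -/

/-- The forward difference operator with step `h`. -/
def fwd (h : ℝ) (u : ℝ → ℝ) (x : ℝ) : ℝ := u (x + h) - u x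

theorem centralDiff_four (h : ℝ) (u : ℝ → ℝ) (x : ℝ) :
    centralDiff 4 h u x = (fwd h)^[4] u (x - 2 * h) := by
  simp only [centralDiff, Finset.sum_range_succ, Finset.sum_range_zero, Function.iterate_succ,
    Function.iterate_zero, Function.comp, id, fwd]
  have e0 : x - ((4 : ℕ) : ℝ) / 2 * h + ((0 : ℕ) : ℝ) * h = x - 2 * h := by push_cast; ring
  have e1 : x - ((4 : ℕ) : ℝ) / 2 * h + ((1 : ℕ) : ℝ) * h = x - 2 * h + h := by push_cast; ring
  have e2 : x - ((4 : ℕ) : ℝ) / 2 * h + ((2 : ℕ) : ℝ) * h = x - 2 * h + h + h := by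
    push_cast; ring
  have e3 : x - ((4 : ℕ) : ℝ) / 2 * h + ((3 : ℕ) : ℝ) * h = x - 2 * h + h + h + h := by
    push_cast; ring
  have e4 : x - ((4 : ℕ) : ℝ) / 2 * h + ((4 : ℕ) : ℝ) * h = x - 2 * h + h + h + h + h := by
    push_cast; ring
  rw [e0, e1, e2, e3, e4]
  norm_num [Nat.choose]
  ring

theorem hasDerivAt_fwd_iterate {u u' : ℝ → ℝ} (hd : ∀ x, HasDerivAt u (u' x) x) (h : ℝ) (k : ℕ) :
    ∀ x, HasDerivAt ((fwd h)^[k] u) ((fwd h)^[k] u' x) x := by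
  induction k with
  | zero => exact hd
  | succ k ih =>
    intro x
    rw [Function.iterate_succ_apply', Function.iterate_succ_apply']
    exact ((ih (x + h)).comp_add_const x h).sub (ih x)

theorem abs_fwd_iterate_succ_le {u u' : ℝ → ℝ} (hd : ∀ x, HasDerivAt u (u' x) x) {h : ℝ}
    (hh : 0 ≤ h) {k : ℕ} {C : ℝ} (hC : ∀ x, |(fwd h)^[k] u' x| ≤ C) (x : ℝ) :
    |(fwd h)^[k + 1] u x| ≤ C * h := by
  rw [Function.iterate_succ_apply']
  have := Convex.norm_image_sub_le_of_norm_hasDerivWithin_le (s := Set.univ)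
    (fun x _ => (hasDerivAt_fwd_iterate hd h k x).hasDerivWithinAt) (fun x _ => hC x) convex_univ
    (Set.mem_univ x) (Set.mem_univ (x + h))
  simpa [fwd, abs_of_nonneg hh] using this

theorem abs_centralDiff_four_le_deriv {u u₁ u₂ u₃ u₄ : ℝ → ℝ} (h₁ : ∀ x, HasDerivAt u (u₁ x) x)
    (h₂ : ∀ x, HasDerivAt u₁ (u₂ x) x) (h₃ : ∀ x, HasDerivAt u₂ (u₃ x) x)
    (h₄ : ∀ x, HasDerivAt u₃ (u₄ x) x) {h C : ℝ} (hh : 0 ≤ h) (hC : ∀ x, |u₄ x| ≤ C) (x : ℝ) :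
    |centralDiff 4 h u x| ≤ C * h ^ 4 := by
  rw [centralDiff_four]
  refine (abs_fwd_iterate_succ_le h₁ hh (abs_fwd_iterate_succ_le h₂ hh
    (abs_fwd_iterate_succ_le h₃ hh (abs_fwd_iterate_succ_le h₄ hh (k := 0) hC))) _).trans_eq ?_
  ring

theorem centralDiff_four_add (h : ℝ) (u v : ℝ → ℝ) (x : ℝ) :
    centralDiff 4 h (u + v) x = centralDiff 4 h u x + centralDiff 4 h v x := by
  simp only [centralDiff, Pi.add_apply, mul_add, Finset.sum_add_distrib]

theorem abs_centralDiff_four_le {u : ℝ → ℝ} {M : ℝ} (hM : ∀ x, |u x| ≤ M) (h x : ℝ) :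
    |centralDiff 4 h u x| ≤ 16 * M := by
  have hM' := fun x => abs_le.1 (hM x)
  simp only [centralDiff, Finset.sum_range_succ, Finset.sum_range_zero]
  norm_num [Nat.choose]
  rw [abs_le]
  constructor <;> linarith [hM' (x - 2 * h), hM' (x - 2 * h + h), hM' x,
    hM' (x - 2 * h + 3 * h), hM' (x - 2 * h + 4 * h)]

/-- If a second difference of a periodic function vanishes, so does the first: it is
`h`-periodic, and its values at `N` equidistant points add up to zero. -/
theorem fwd_eq_zero_of_fwd_fwd {u : ℝ → ℝ} (hu : Function.Periodic u (2 * Real.pi)) {N : ℕ}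
    (hN : 0 < N) (h : fwd (2 * Real.pi / N) (fwd (2 * Real.pi / N) u) = 0) :
    fwd (2 * Real.pi / N) u = 0 := by
  set t := 2 * Real.pi / N with ht
  have hN' : (N : ℝ) ≠ 0 := by exact_mod_cast hN.ne'
  ext x
  have h1 : ∀ k : ℕ, fwd t u (x + k * t) = fwd t u x := by
    intro k
    induction k with
    | zero => simp
    | succ k ih =>
      have := congrFun h (x + k * t)
      simp only [Pi.zero_apply] at this
      rw [fwd, sub_eq_zero] at this
      rw [← ih, ← this]
      push_cast
      ring_nf
  have h2 : ∑ k ∈ Finset.range N, fwd t u (x + k * t) = 0 := by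
    have h3 : ∀ k ∈ Finset.range N, fwd t u (x + k * t) =
        u (x + (k + 1 : ℕ) * t) - u (x + k * t) := by
      intro k _
      rw [fwd]
      push_cast
      ring_nf
    rw [Finset.sum_congr rfl h3, Finset.sum_range_sub (fun k : ℕ => u (x + k * t))]
    have : x + N * t = x + 2 * Real.pi := by
      rw [ht]
      field_simp
    simp [this, hu x]
  simp only [h1, Finset.sum_const, Finset.card_range, nsmul_eq_mul] at h2
  exact (mul_eq_zero.1 h2).resolve_left hN'

theorem fwd_periodic {u : ℝ → ℝ} {c : ℝ} (hu : Function.Periodic u c) (h : ℝ) :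
    Function.Periodic (fwd h u) c := by
  intro x
  simp only [fwd]
  rw [hu x, add_right_comm, hu]

theorem bddAbove_modulus_four {f : ℝ → ℝ} {M : ℝ} (hM : ∀ x, |f x| ≤ M) (t : ℝ) :
    BddAbove {d : ℝ | ∃ h x : ℝ, 0 < h ∧ h ≤ t ∧ x ∈ Set.Icc (-Real.pi) Real.pi ∧
      d = |centralDiff 4 h f x|} := by
  refine ⟨16 * M, ?_⟩
  rintro _ ⟨h, x, -, -, -, rfl⟩
  exact abs_centralDiff_four_le hM h x

theorem centralDiff_periodic {f : ℝ → ℝ} (hper : Function.Periodic f (2 * Real.pi)) (k : ℕ)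
    (h : ℝ) : Function.Periodic (centralDiff k h f) (2 * Real.pi) := by
  intro x
  simp only [centralDiff]
  refine Finset.sum_congr rfl fun i _ => ?_
  rw [← hper (x - (k : ℝ) / 2 * h + i * h)]
  ring_nf

/-- The modulus of smoothness of a nonconstant function does not vanish: otherwise all small steps
`2π / N` would be periods. -/
theorem modulus_four_pos {f : ℝ → ℝ} (hf : Continuous f) (hper : Function.Periodic f (2 * Real.pi))
    {M : ℝ} (hM : ∀ x, |f x| ≤ M) {x₀ x₁ : ℝ} (hne : f x₀ ≠ f x₁) {t : ℝ} (ht : 0 < t) :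
    0 < modulus 4 f t := by
  by_contra hcon
  push Not at hcon
  have hzero : ∀ h, 0 < h → h ≤ t → (fwd h)^[4] f = 0 := by
    intro h h0 hle
    ext x
    obtain ⟨y, hy, hxy⟩ := (centralDiff_periodic hper 4 h).exists_mem_Ico Real.two_pi_pos
      (x + 2 * h) (-Real.pi)
    have h1 : |centralDiff 4 h f y| ≤ 0 := by
      refine le_trans ?_ hcon
      refine le_csSup (bddAbove_modulus_four hM t) ⟨h, y, h0, hle, ⟨hy.1, ?_⟩, rfl⟩
      linarith [hy.2]
    have h2 := abs_eq_zero.1 (le_antisymm h1 (abs_nonneg _))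
    rw [← hxy, centralDiff_four] at h2
    simpa using h2
  have hper1 : ∀ᶠ N : ℕ in atTop, Function.Periodic f (2 * Real.pi / N) := by
    have hlim : Tendsto (fun N : ℕ => 2 * Real.pi / (N : ℝ)) atTop (nhds 0) :=
      tendsto_const_div_atTop_nhds_zero_nat _
    filter_upwards [hlim.eventually (ge_mem_nhds ht), eventually_gt_atTop 0] with N hN hN0 x
    have hpos : 0 < 2 * Real.pi / (N : ℝ) := by
      have : (0 : ℝ) < N := by exact_mod_cast hN0
      positivity
    have h4 := hzero _ hpos hN
    have p1 := fwd_periodic hper (2 * Real.pi / N)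
    have p2 := fwd_periodic p1 (2 * Real.pi / N)
    have h3 := fwd_eq_zero_of_fwd_fwd p2 hN0 h4
    have h2 := fwd_eq_zero_of_fwd_fwd p1 hN0 h3
    have h1 := congrFun (fwd_eq_zero_of_fwd_fwd hper hN0 h2) x
    simpa [fwd, sub_eq_zero] using h1
  -- the points congruent to `x₀` modulo `2π / N` that are closest to `x₁` from above tend to `x₁`
  have hlim2 : Tendsto (fun N : ℕ => x₁ + (x₀ - x₁ - 2 * Real.pi / N *
      ⌊(x₀ - x₁) / (2 * Real.pi / N)⌋)) atTop (nhds (x₁ + 0)) := by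
    refine tendsto_const_nhds.add ?_
    have hlim : Tendsto (fun N : ℕ => 2 * Real.pi / (N : ℝ)) atTop (nhds 0) :=
      tendsto_const_div_atTop_nhds_zero_nat _
    refine squeeze_zero' ?_ ?_ hlim <;> filter_upwards [eventually_gt_atTop 0] with N hN0
    all_goals
      have hpos : 0 < 2 * Real.pi / (N : ℝ) := by
        have : (0 : ℝ) < N := by exact_mod_cast hN0
        positivity
    · have := Int.floor_le ((x₀ - x₁) / (2 * Real.pi / N))
      rw [le_div_iff₀ hpos] at this
      linarith
    · have := Int.lt_floor_add_one ((x₀ - x₁) / (2 * Real.pi / N))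
      rw [div_lt_iff₀ hpos] at this
      linarith
  rw [add_zero] at hlim2
  have hlim3 := (hf.tendsto x₁).comp hlim2
  refine hne (tendsto_nhds_unique (tendsto_const_nhds.congr' ?_) hlim3)
  filter_upwards [hper1] with N hN
  have := hN.sub_int_mul_eq ⌊(x₀ - x₁) / (2 * Real.pi / N)⌋ (x := x₀)
  rw [← this, Function.comp]
  congr 1
  ring

/-! ### Measure of neighbourhoods of a grid -/

/-- The `r / m`-neighbourhoods of the points `2πj / m` fill a fraction of every interval that is
independent of `m`. -/
theorem volume_near_grid_ge {x₀ l r : ℝ} (hl : 0 < l) (hr : 0 < r) (hr1 : r ≤ 1) {m : ℕ}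
    (hm : 24 * Real.pi / l ≤ m) :
    ENNReal.ofReal (l * r / (2 * Real.pi)) ≤
      volume {x : ℝ | x ∈ Set.Icc x₀ (x₀ + l) ∧ ∃ j : ℤ, |m * x - 2 * Real.pi * j| ≤ r} := by
  have hpi := Real.pi_pos
  have hpi3 := Real.pi_gt_three
  have hm0 : (0 : ℝ) < m := lt_of_lt_of_le (by positivity) hm
  rw [div_le_iff₀ hl] at hm
  set j₀ : ℤ := ⌈m * x₀ / (2 * Real.pi)⌉ with hj₀
  set k : ℕ := ⌊m * l / (2 * Real.pi)⌋₊ with hk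
  have hj1 : m * x₀ ≤ 2 * Real.pi * j₀ := by
    have := Int.le_ceil (m * x₀ / (2 * Real.pi))
    rw [div_le_iff₀ (by positivity)] at this
    linarith
  have hj2 : 2 * Real.pi * j₀ ≤ m * x₀ + 2 * Real.pi := by
    have := Int.ceil_lt_add_one (m * x₀ / (2 * Real.pi))
    rw [← sub_lt_iff_lt_add, lt_div_iff₀ (by positivity)] at this
    linarith
  have hk1 : 2 * Real.pi * k ≤ m * l := by
    have := Nat.floor_le (a := m * l / (2 * Real.pi)) (by positivity)
    rw [le_div_iff₀ (by positivity)] at this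
    linarith
  have hk2 : m * l ≤ 2 * Real.pi * (k + 1) := by
    have := Nat.lt_floor_add_one (m * l / (2 * Real.pi))
    rw [div_lt_iff₀ (by positivity)] at this
    linarith
  have hk3 : 3 ≤ k := by
    have : 2 * Real.pi * 11 ≤ 2 * Real.pi * k := by linarith
    have := le_of_mul_le_mul_left this (by positivity)
    have : 11 ≤ k := by exact_mod_cast this
    omega
  let I : ℕ → Set ℝ := fun i => Set.Icc ((2 * Real.pi * (j₀ + 1 + i : ℤ) - r) / m)
    ((2 * Real.pi * (j₀ + 1 + i : ℤ) + r) / m)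
  have hdisj : Set.PairwiseDisjoint (↑(Finset.range (k - 3))) I := by
    have key : ∀ i i' : ℕ, i < i' → Disjoint (I i) (I i') := by
      intro i i' hii
      rw [Set.disjoint_left]
      rintro x ⟨-, hx⟩ ⟨hx', -⟩
      rw [le_div_iff₀ hm0] at hx
      rw [div_le_iff₀ hm0] at hx'
      have : (i : ℝ) + 1 ≤ i' := by exact_mod_cast hii
      push_cast at hx hx'
      nlinarith
    intro i _ i' _ hne
    rcases lt_or_gt_of_ne hne with h | h
    exacts [key i i' h, (key i' i h).symm]
  have hsub : (⋃ i ∈ Finset.range (k - 3), I i) ⊆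
      {x : ℝ | x ∈ Set.Icc x₀ (x₀ + l) ∧ ∃ j : ℤ, |m * x - 2 * Real.pi * j| ≤ r} := by
    intro x hx
    simp only [Set.mem_iUnion, Finset.mem_range] at hx
    obtain ⟨i, hi, hx1, hx2⟩ := hx
    rw [div_le_iff₀ hm0] at hx1
    rw [le_div_iff₀ hm0] at hx2
    have hi' : (i : ℝ) + 4 ≤ k := by
      have : i + 4 ≤ k := by omega
      exact_mod_cast this
    have hi0 : (0 : ℝ) ≤ i := i.cast_nonneg
    refine ⟨⟨?_, ?_⟩, j₀ + 1 + i, ?_⟩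
    · refine le_of_mul_le_mul_left (?_ : m * x₀ ≤ m * x) hm0
      push_cast at hx1
      nlinarith
    · refine le_of_mul_le_mul_left (?_ : m * x ≤ m * (x₀ + l)) hm0
      push_cast at hx2
      nlinarith
    · rw [abs_le]
      constructor <;> linarith
  refine le_trans ?_ (measure_mono hsub)
  rw [measure_biUnion_finset hdisj fun i _ => measurableSet_Icc]
  have hvol : ∀ i ∈ Finset.range (k - 3), volume (I i) = ENNReal.ofReal (2 * r / m) := by
    intro i _
    rw [Real.volume_Icc]
    congr 1
    ring
  rw [Finset.sum_congr rfl hvol, Finset.sum_const, Finset.card_range, nsmul_eq_mul,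
    ← ENNReal.ofReal_natCast, ← ENNReal.ofReal_mul (by positivity)]
  refine ENNReal.ofReal_le_ofReal ?_
  rw [Nat.cast_sub hk3, ← mul_div_assoc, div_le_div_iff₀ (by positivity) hm0]
  push_cast
  have : l * m ≤ 4 * Real.pi * (k - 3) := by nlinarith
  nlinarith

/-! ### The perturbation step -/

theorem abs_centralDiff_four_le_of_mem_trigSpan {n : ℕ} (hn : 1 ≤ n) {u : ℝ → ℝ}
    (hu : u ∈ trigSpan (freq n)) {M : ℝ} (hM : ∀ x, |u x| ≤ M) {h : ℝ} (hh : 0 ≤ h) (x : ℝ) :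
    |centralDiff 4 h u x| ≤ (2 * n) ^ 4 * M * h ^ 4 := by
  obtain ⟨u₁, hu₁, h₁⟩ := exists_deriv_mem_trigSpan hu
  obtain ⟨u₂, hu₂, h₂⟩ := exists_deriv_mem_trigSpan (trigSpan_freqNZ_le n hu₁)
  obtain ⟨u₃, hu₃, h₃⟩ := exists_deriv_mem_trigSpan (trigSpan_freqNZ_le n hu₂)
  obtain ⟨u₄, hu₄, h₄⟩ := exists_deriv_mem_trigSpan (trigSpan_freqNZ_le n hu₃)
  have b₁ := bernstein_inequality hn hu h₁ hM
  have b₂ := bernstein_inequality hn (trigSpan_freqNZ_le n hu₁) h₂ b₁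
  have b₃ := bernstein_inequality hn (trigSpan_freqNZ_le n hu₂) h₃ b₂
  have b₄ := bernstein_inequality hn (trigSpan_freqNZ_le n hu₃) h₄ b₃
  refine (abs_centralDiff_four_le_deriv h₁ h₂ h₃ h₄ hh b₄ x).trans_eq ?_
  ring

/-- The mean value of `1 - cos u - 2 / q + (2 / q) * ((1 + cos u) / 2) ^ q`. -/
noncomputable def rieszMean (q : ℕ) : ℝ := 1 - 2 / q + 2 / q * cosPowMean q

/-- A nonnegative trigonometric polynomial with mean `1`. Without the term with the power, which
has small mean but is concentrated near `0`, it would be a polynomial of degree one that is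
negative near `0`. -/
noncomputable def rieszFactor (q : ℕ) (u : ℝ) : ℝ :=
  (1 - Real.cos u - 2 / q + 2 / q * ((1 + Real.cos u) / 2) ^ q) / rieszMean q

theorem half_le_rieszMean {q : ℕ} (hq : 4 ≤ q) : 1 / 2 ≤ rieszMean q := by
  have h := cosPowMean_pos q
  have hq' : (4 : ℝ) ≤ q := by exact_mod_cast hq
  have h1 : 2 / (q : ℝ) ≤ 1 / 2 := by
    rw [div_le_div_iff₀ (by linarith) (by norm_num)]
    linarith
  have h2 : 0 ≤ 2 / (q : ℝ) * cosPowMean q := by positivity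
  rw [rieszMean]
  linarith

theorem rieszMean_le {q : ℕ} (hq : 2 ≤ q) : rieszMean q ≤ 1 - 1 / q := by
  have h := cosPowMean_le_half hq
  have h2 : 2 / (q : ℝ) * cosPowMean q ≤ 2 / q * (1 / 2) :=
    mul_le_mul_of_nonneg_left h (by positivity)
  rw [rieszMean]
  have : (2 : ℝ) / q * (1 / 2) = 1 / q := by ring
  have h3 : (2 : ℝ) / q = 1 / q + 1 / q := by ring
  linarith

/-- This is Bernoulli's inequality for `(1 + cos u) / 2 = 1 - (1 - cos u) / 2`. -/
theorem rieszFactor_nonneg {q : ℕ} (hq : 4 ≤ q) (u : ℝ) : 0 ≤ rieszFactor q u := by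
  have hq' : (0 : ℝ) < q := by exact_mod_cast (by omega : 0 < q)
  have hb := one_add_mul_le_pow (a := (Real.cos u - 1) / 2)
    (by linarith [Real.neg_one_le_cos u]) q
  refine div_nonneg ?_ (by linarith [half_le_rieszMean hq])
  have h1 : 1 + (Real.cos u - 1) / 2 = (1 + Real.cos u) / 2 := by ring
  rw [h1] at hb
  have h2 := mul_le_mul_of_nonneg_left hb (by positivity : 0 ≤ 2 / (q : ℝ))
  have h3 : 2 / (q : ℝ) * (1 + q * ((Real.cos u - 1) / 2)) = 2 / q + (Real.cos u - 1) := by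
    field_simp
  linarith

theorem rieszFactor_pos {q : ℕ} (hq : 4 ≤ q) {u : ℝ} (hu : Real.cos u ≤ 0) :
    0 < rieszFactor q u := by
  have hq' : (4 : ℝ) ≤ q := by exact_mod_cast hq
  refine div_pos ?_ (by linarith [half_le_rieszMean hq])
  have h1 : 2 / (q : ℝ) ≤ 1 / 2 := by
    rw [div_le_div_iff₀ (by linarith) (by norm_num)]
    linarith
  have h2 : 0 ≤ 2 / (q : ℝ) * ((1 + Real.cos u) / 2) ^ q :=
    mul_nonneg (by positivity) (pow_nonneg (by linarith [Real.neg_one_le_cos u]) _)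
  linarith

theorem riesz_main_part_le {q : ℕ} (hq : 4 ≤ q) {u : ℝ} {j : ℤ}
    (h : (u - 2 * Real.pi * j) ^ 2 ≤ 1 / q) :
    (rieszMean q - Real.cos u) / rieszMean q ≤ -(1 / (2 * q)) := by
  have hcos : 1 - 1 / q / 2 ≤ Real.cos u := by
    have h1 : Real.cos u = Real.cos (u - 2 * Real.pi * j) := by
      rw [mul_comm (2 * Real.pi), Real.cos_sub_int_mul_two_pi]
    rw [h1]
    refine le_trans ?_ (Real.one_sub_sq_div_two_le_cos)
    linarith
  have hμ1 := rieszMean_le (q := q) (by omega)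
  have hμ2 := half_le_rieszMean hq
  have hq2 : 1 / (2 * (q : ℝ)) = 1 / q / 2 := by ring
  have hq3 : 0 < 1 / (q : ℝ) := by
    have : (0 : ℝ) < q := by exact_mod_cast (by omega : 0 < q)
    positivity
  rw [div_le_iff₀ (by linarith), hq2]
  nlinarith

/-- The derivative of `F` is multiplied by `rieszFactor (p ^ 8) (m x)`, which gives `Φ`, and by the
main part of this factor, which gives `g`. Both stay close to `F`; they are still closer to each
other, although `g` has a much lower degree. -/
theorem exists_perturbed_pair {d : ℕ} {F F₁ : ℝ → ℝ} (hF : F ∈ trigSpan (freq d))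
    (hF₁ : ∀ x, HasDerivAt F (F₁ x) x) :
    ∃ C > 0, ∀ p ≥ 2, ∀ m > d, ∃ g Φ : ℝ → ℝ,
      g ∈ trigSpan (freq (d + m)) ∧ Φ ∈ trigSpan (freq (d + p ^ 8 * m)) ∧
      (∀ x, HasDerivAt g
        (F₁ x * ((rieszMean (p ^ 8) - Real.cos (m * x)) / rieszMean (p ^ 8))) x) ∧
      (∀ x, HasDerivAt Φ (F₁ x * rieszFactor (p ^ 8) (m * x)) x) ∧
      (∀ x, |g x - F x| ≤ C / m) ∧ (∀ x, |Φ x - g x| ≤ C / (p ^ 12 * m)) ∧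
      ∀ h ≥ 0, ∀ x, |centralDiff 4 h g x| ≤ C * m ^ 3 * h ^ 4 := by
  have hF₁mem : F₁ ∈ trigSpan (freqNZ d) := by
    obtain ⟨u, hu, h⟩ := exists_deriv_mem_trigSpan hF
    have : F₁ = u := funext fun x => (hF₁ x).unique (h x)
    exact this ▸ hu
  have hF₁mem' := trigSpan_freqNZ_le d hF₁mem
  obtain ⟨F₂, hF₂mem, hF₂⟩ := exists_deriv_mem_trigSpan hF₁mem'
  obtain ⟨M₀, hM₀⟩ := exists_bound_of_mem_trigSpan hF
  obtain ⟨M₁, hM₁⟩ := exists_bound_of_mem_trigSpan hF₁mem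
  obtain ⟨M₂, hM₂⟩ := exists_bound_of_mem_trigSpan hF₂mem
  have hM₀0 : 0 ≤ M₀ := (abs_nonneg _).trans (hM₀ 0)
  have hM₁0 : 0 ≤ M₁ := (abs_nonneg _).trans (hM₁ 0)
  have hM₂0 : 0 ≤ M₂ := (abs_nonneg _).trans (hM₂ 0)
  set B := 2 * M₁ + 7 * M₂ with hB
  have hB0 : 0 ≤ B := by positivity
  set D := (2 * (d + 1 : ℕ)) ^ 4 * M₀ with hD
  have hD0 : 0 ≤ D := by positivity
  refine ⟨D + 512 * B + 1, by positivity, fun p hp m hm => ?_⟩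
  set q := p ^ 8 with hq
  have hq256 : 2 ^ 8 ≤ q := Nat.pow_le_pow_left hp 8
  have hq4 : 4 ≤ q := by omega
  have hq0 : (0 : ℝ) < q := by exact_mod_cast (by omega : 0 < q)
  have hp0 : (0 : ℝ) < p := by exact_mod_cast (by omega : 0 < p)
  have hm0 : (0 : ℝ) < m := by exact_mod_cast (by omega : 0 < m)
  have hm1 : (1 : ℝ) ≤ m := by exact_mod_cast (by omega : 1 ≤ m)
  set μ := rieszMean q with hμ
  have hμ2 : 1 / 2 ≤ μ := half_le_rieszMean hq4
  have hμ0 : 0 < μ := by linarith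
  have hμinv : 1 / μ ≤ 2 := by
    rw [div_le_iff₀ hμ0]
    linarith
  have hcos : Real.cos ∈ trigSpan (freqNZ 1) := by
    simpa using cos_mem_trigSpan (S := freqNZ 1) (j := 1) (by simp [freqNZ])
  -- `G' = F' cos (m ·)` and `W' = F' w (m ·)`, where `w` is the centred power
  obtain ⟨G, hGmem, hG⟩ :=
    exists_primitive_mem_trigSpan (mul_dilate_mem_trigSpan hm hF₁mem' hcos)
  obtain ⟨W, hWmem, hW⟩ :=
    exists_primitive_mem_trigSpan (mul_dilate_mem_trigSpan hm hF₁mem' (cosPow_sub_mean_mem q))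
  obtain ⟨v, hvmem, hv⟩ := exists_primitive_mem_trigSpan (cosPow_sub_mean_mem q)
  rw [one_mul] at hGmem
  have hGmem' : (fun x => G x - G 0) ∈ trigSpan (freq (d + m)) :=
    sub_mem (trigSpan_freqNZ_le _ hGmem) (const_mem_trigSpan (zero_mem_freq _) _)
  have hWmem' : (fun x => W x - W 0) ∈ trigSpan (freq (d + q * m)) :=
    sub_mem (trigSpan_freqNZ_le _ hWmem) (const_mem_trigSpan (zero_mem_freq _) _)
  have hGb : ∀ x, |G x - G 0| ≤ B / m := by
    intro x
    have := abs_le_of_hasDerivAt_mul_dilate hm0 hF₂ Real.hasDerivAt_sin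
      (fun x => (hG x).sub_const (G 0)) (periodic_of_mem_trigSpan hGmem') (sub_self _) hM₁ hM₂
      Real.abs_sin_le_one x
    rwa [mul_one] at this
  have hWb : ∀ x, |W x - W 0| ≤ B * (7 * cosPowMean q) / m := by
    refine abs_le_of_hasDerivAt_mul_dilate (h := fun u => v u - v 0) hm0 hF₂
      (fun x => (hv x).sub_const (v 0))
      (fun x => (hW x).sub_const (W 0)) (periodic_of_mem_trigSpan hWmem') (sub_self _) hM₁ hM₂
      fun x => ?_
    refine (abs_primitive_cosPow_sub_le (periodic_of_mem_trigSpan hvmem) hv x).trans ?_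
    have := cosPowMean_pos q
    have hpi := Real.pi_lt_d2
    nlinarith
  set g : ℝ → ℝ := F + (-1 / μ) • fun x => G x - G 0 with hg
  have hgmem : g ∈ trigSpan (freq (d + m)) :=
    add_mem (trigSpan_freq_mono (Nat.le_add_right d m) hF) (Submodule.smul_mem _ _ hGmem')
  set Φ : ℝ → ℝ := g + (2 / (q * μ)) • fun x => W x - W 0 with hΦ
  have hG2 : ∀ x, |((-1 / μ) • fun x => G x - G 0) x| ≤ 2 * (B / m) := by
    intro x
    rw [Pi.smul_apply, smul_eq_mul, abs_mul, neg_div, abs_neg,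
      abs_of_pos (by positivity : 0 < 1 / μ)]
    exact mul_le_mul hμinv (hGb x) (abs_nonneg _) (by norm_num)
  have hgd : ∀ x, HasDerivAt g (F₁ x * ((μ - Real.cos (m * x)) / μ)) x := by
    intro x
    refine ((hF₁ x).add (((hG x).sub_const (G 0)).const_smul (-1 / μ))).congr_deriv ?_
    simp only [smul_eq_mul]
    field_simp
    ring
  refine ⟨g, Φ, hgmem, ?_, hgd, ?_, ?_, ?_, ?_⟩
  · refine add_mem (trigSpan_freq_mono ?_ hgmem) (Submodule.smul_mem _ _ hWmem')
    have : 1 * m ≤ q * m := Nat.mul_le_mul_right m (by omega)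
    omega
  · intro x
    refine ((hgd x).add (((hW x).sub_const (W 0)).const_smul (2 / (q * μ)))).congr_deriv ?_
    have hμ' : μ = 1 - 2 / q + 2 / q * cosPowMean q := rfl
    simp only [smul_eq_mul, rieszFactor, ← hμ]
    have h1 : 2 / (q * μ) = 2 / q / μ := by field_simp
    rw [h1]
    generalize ((1 + Real.cos (m * x)) / 2) ^ q = e
    have h2 : 1 - Real.cos (m * x) - 2 / q + 2 / q * e =
        μ - Real.cos (m * x) + 2 / q * (e - cosPowMean q) := by
      rw [hμ']
      ring
    rw [h2]
    ring
  · intro x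
    have : g x - F x = ((-1 / μ) • fun x => G x - G 0) x := by simp [hg]
    rw [this]
    refine (hG2 x).trans ?_
    rw [← mul_div_assoc]
    gcongr
    linarith
  · intro x
    have h1 : Φ x - g x = 2 / q * (1 / μ) * (W x - W 0) := by
      simp only [hΦ, Pi.add_apply, Pi.smul_apply, smul_eq_mul, add_sub_cancel_left]
      field_simp
    have hp4 : cosPowMean q * p ^ 4 ≤ 1 := cosPowMean_pow_eight_le (by omega)
    have hc0 := cosPowMean_pos q
    rw [h1, abs_mul, abs_of_pos (by positivity : 0 < 2 / q * (1 / μ))]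
    calc 2 / q * (1 / μ) * |W x - W 0|
        ≤ 2 / q * 2 * (B * (7 * cosPowMean q) / m) := by
          gcongr
          exact hWb x
      _ = 28 * B * (cosPowMean q * p ^ 4) / (p ^ 12 * m) := by
          have : (q : ℝ) = p ^ 8 := by rw [hq]; push_cast; rfl
          rw [this]
          field_simp
          ring
      _ ≤ 28 * B * 1 / (p ^ 12 * m) := by gcongr
      _ ≤ _ := by
          gcongr
          linarith
  · intro h hh x
    have h1 := abs_centralDiff_four_le_of_mem_trigSpan (n := d + 1) (by omega)
      (trigSpan_freq_mono (Nat.le_succ d) hF) hM₀ hh x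
    have h2 := abs_centralDiff_four_le_of_mem_trigSpan (n := 2 * m) (by omega)
      (trigSpan_freq_mono (by omega) ((trigSpan (freq (d + m))).smul_mem (-1 / μ) hGmem')) hG2 hh x
    rw [hg, centralDiff_four_add]
    refine (abs_add_le _ _).trans ((add_le_add h1 h2).trans ?_)
    rw [← hD, ← add_mul]
    refine mul_le_mul_of_nonneg_right ?_ (by positivity)
    have h3 : (2 * ((2 * m : ℕ) : ℝ)) ^ 4 * (2 * (B / m)) = 512 * B * m ^ 3 := by
      push_cast
      field_simp
      ring
    rw [h3]
    have h4 : (1 : ℝ) ≤ m ^ 3 := one_le_pow₀ hm1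
    nlinarith

set_option maxHeartbeats 800000 in
/-- The inductive step. In `(a, b)` the derivative of `g` is below `-τ / (2 q)` near the points
`2πj / m`. Since `g` is so close to all the functions `f` in question, Bernstein's inequality carries
negativity of the derivative over to the polynomials `P` of degree `n = p ^ 3 m` that approximate
`f` well, on a set whose measure is bounded from below in terms of `p` alone. -/
theorem exists_perturbation {d : ℕ} {F F₁ : ℝ → ℝ} (hF : F ∈ trigSpan (freq d))
    (hF₁ : ∀ x, HasDerivAt F (F₁ x) x) {a b x₀ : ℝ} (hx₀ : x₀ ∈ Set.Ioo a b) (hpos : 0 < F₁ x₀)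
    {ε : ℕ → ℝ} (hε : Tendsto ε atTop (nhds 0)) {A : ℝ} (hA : 0 ≤ A) (N : ℕ) {δ : ℝ} (hδ : 0 < δ) :
    ∃ (d' : ℕ) (Φ Φ₁ : ℝ → ℝ), Φ ∈ trigSpan (freq d') ∧ (∀ x, HasDerivAt Φ (Φ₁ x) x) ∧
      (∀ x, ∃ c ≥ 0, Φ₁ x = c * F₁ x) ∧ (∃ x₁ ∈ Set.Ioo a b, 0 < Φ₁ x₁) ∧
      (∀ x, |Φ x - F x| ≤ δ) ∧ ∃ η > 0, ∃ n ≥ N, ∃ Ω > 0, ∀ f : ℝ → ℝ, (∀ x, |f x - Φ x| ≤ η) →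
        modulus 4 f (Real.pi / n) ≤ Ω ∧ ∀ P ∈ trigSpan (freq n), (∀ x, |f x - P x| ≤ A * Ω) →
          ENNReal.ofReal (ε n) < volume {x | x ∈ Set.Ioo a b ∧ deriv P x < 0} := by
  obtain ⟨C, hC, hpair⟩ := exists_perturbed_pair hF hF₁
  have hcont : Continuous F₁ := by
    obtain ⟨u, hu, h⟩ := exists_deriv_mem_trigSpan hF
    obtain ⟨w, -, hw⟩ := exists_deriv_mem_trigSpan (trigSpan_freqNZ_le _ hu)
    have : F₁ = u := funext fun x => (hF₁ x).unique (h x)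
    exact this ▸ continuous_iff_continuousAt.2 fun x => (hw x).continuousAt
  set τ := F₁ x₀ / 2 with hτ
  have hτ0 : 0 < τ := by positivity
  obtain ⟨l, hl, hJ⟩ : ∃ l > 0, ∀ x ∈ Set.Icc x₀ (x₀ + l), x ∈ Set.Ioo a b ∧ τ < F₁ x := by
    have h1 : ∀ᶠ x in nhds x₀, x ∈ Set.Ioo a b ∧ τ < F₁ x :=
      (isOpen_Ioo.eventually_mem hx₀).and
        (hcont.continuousAt.eventually (lt_mem_nhds (by rw [hτ]; linarith)))
    obtain ⟨e, he, hball⟩ := Metric.eventually_nhds_iff.1 h1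
    refine ⟨e / 2, by positivity, fun x hx => hball ?_⟩
    rw [Real.dist_eq, abs_lt]
    constructor <;> linarith [hx.1, hx.2]
  set K := 16 * (C + 1) + 100 * C with hK
  have hK0 : 0 < K := by positivity
  -- `p` is large enough for Bernstein's bound `2 (A + 1) K / p ^ 9` to be less than `τ / (2 p ^ 8)`
  obtain ⟨p, hp⟩ := exists_nat_gt (max 2 (4 * (A + 1) * K / τ))
  have hp2 : 2 ≤ p := by
    have := (le_max_left _ _).trans_lt hp
    have : 2 < p := by exact_mod_cast this
    omega
  have hpτ : 4 * (A + 1) * K < p * τ := by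
    have := (le_max_right _ _).trans_lt hp
    rwa [div_lt_iff₀ hτ0] at this
  have hp0 : (0 : ℝ) < p := by exact_mod_cast (by omega : 0 < p)
  have hp1 : (1 : ℝ) ≤ p := by exact_mod_cast (by omega : 1 ≤ p)
  have hpi := Real.pi_pos
  set r : ℝ := 1 / p ^ 4 with hr
  have hr0 : 0 < r := by positivity
  have hr1 : r ≤ 1 := by
    rw [hr, div_le_one (by positivity)]
    exact one_le_pow₀ hp1
  obtain ⟨N₁, hN₁⟩ := eventually_atTop.1
    (hε.eventually (gt_mem_nhds (show (0 : ℝ) < l * r / (2 * Real.pi) by positivity)))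
  obtain ⟨m, hm⟩ := exists_nat_gt
    (max (max (d : ℝ) N) (max N₁ (max (24 * Real.pi / l) (2 * C / δ))))
  have hmd : d < m := by
    have := ((le_max_left _ _).trans (le_max_left _ _)).trans_lt hm
    exact_mod_cast this
  have hmN : N < m := by
    have := ((le_max_right _ _).trans (le_max_left _ _)).trans_lt hm
    exact_mod_cast this
  have hmN₁ : N₁ < m := by
    have := ((le_max_left _ _).trans (le_max_right _ _)).trans_lt hm
    exact_mod_cast this
  have hml : 24 * Real.pi / l ≤ m :=
    (((le_max_left _ _).trans (le_max_right _ _)).trans (le_max_right _ _)).trans hm.le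
  have hmδ : 2 * C / δ ≤ m :=
    (((le_max_right _ _).trans (le_max_right _ _)).trans (le_max_right _ _)).trans hm.le
  have hm0 : (0 : ℝ) < m := by exact_mod_cast (by omega : 0 < m)
  obtain ⟨g, Φ, hgmem, hΦmem, hgd, hΦd, hgF, hΦg, hgdiff⟩ := hpair p hp2 m hmd
  set q := p ^ 8 with hq
  have hqp : (q : ℝ) = p ^ 8 := by rw [hq]; push_cast; rfl
  have hq256 : 2 ^ 8 ≤ q := Nat.pow_le_pow_left hp2 8
  have hq0 : (0 : ℝ) < q := by exact_mod_cast (by omega : 0 < q)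
  have hrq : r ^ 2 = 1 / q := by
    rw [hr, hqp, div_pow, ← pow_mul, one_pow]
  set n := p ^ 3 * m with hn
  have hp3 : 2 ≤ p ^ 3 := hp2.trans (Nat.le_self_pow (by norm_num) p)
  have hnm : 2 * m ≤ n := Nat.mul_le_mul_right m hp3
  have hnr : (n : ℝ) = p ^ 3 * m := by rw [hn]; push_cast; rfl
  have hn0 : (0 : ℝ) < n := by rw [hnr]; positivity
  refine ⟨_, Φ, _, hΦmem, hΦd, fun x => ⟨_, rieszFactor_nonneg (by omega) _, mul_comm _ _⟩,
    ?_, ?_, 1 / (p ^ 12 * m), by positivity, n, by omega, K / (p ^ 12 * m), by positivity, ?_⟩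
  · have hπl : Real.pi / m ≤ l := by
      rw [div_le_iff₀ hl] at hml
      rw [div_le_iff₀ hm0]
      linarith
    rcases le_total (Real.cos (m * x₀)) 0 with h | h
    · have := hJ x₀ ⟨le_rfl, by linarith⟩
      exact ⟨x₀, this.1, mul_pos (hτ0.trans this.2) (rieszFactor_pos (by omega) h)⟩
    · have := hJ (x₀ + Real.pi / m) ⟨by linarith [div_pos hpi hm0], by linarith⟩
      refine ⟨_, this.1, mul_pos (hτ0.trans this.2) (rieszFactor_pos (by omega) ?_)⟩
      have h1 : m * (x₀ + Real.pi / m) = m * x₀ + Real.pi := by field_simp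
      rw [h1, Real.cos_add_pi]
      linarith
  · intro x
    rw [div_le_iff₀ hδ] at hmδ
    have h1 : C / (p ^ 12 * m) ≤ C / m := by
      refine div_le_div_of_nonneg_left hC.le hm0 ?_
      exact le_mul_of_one_le_left hm0.le (one_le_pow₀ hp1)
    have h2 : C / m ≤ δ / 2 := by
      rw [div_le_div_iff₀ hm0 (by norm_num)]
      linarith
    calc |Φ x - F x| = |(Φ x - g x) + (g x - F x)| := by ring_nf
      _ ≤ |Φ x - g x| + |g x - F x| := abs_add_le _ _
      _ ≤ δ := by linarith [hΦg x, hgF x]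
  intro f hf
  have hfg : ∀ x, |f x - g x| ≤ (C + 1) / (p ^ 12 * m) := by
    intro x
    calc |f x - g x| = |(f x - Φ x) + (Φ x - g x)| := by ring_nf
      _ ≤ |f x - Φ x| + |Φ x - g x| := abs_add_le _ _
      _ ≤ 1 / (p ^ 12 * m) + C / (p ^ 12 * m) := add_le_add (hf x) (hΦg x)
      _ = _ := by ring
  constructor
  · refine csSup_le ⟨_, Real.pi / n, 0, by positivity, le_rfl, ⟨by linarith, hpi.le⟩, rfl⟩ ?_
    rintro _ ⟨h, x, hh0, hh, -, rfl⟩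
    have h1 : f = g + (f - g) := by ring
    rw [h1, centralDiff_four_add]
    have h2 := hgdiff h hh0.le x
    have h3 := abs_centralDiff_four_le (u := f - g) hfg h x
    have h4 : h ^ 4 ≤ 100 / n ^ 4 := by
      calc h ^ 4 ≤ (Real.pi / n) ^ 4 := pow_le_pow_left₀ hh0.le hh 4
        _ = (Real.pi ^ 2) ^ 2 / n ^ 4 := by ring
        _ ≤ 100 / n ^ 4 := by
          have hpi2 : Real.pi ^ 2 ≤ 10 := by nlinarith [Real.pi_lt_d2]
          gcongr
          nlinarith [sq_nonneg Real.pi]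
    have h5 : C * m ^ 3 * h ^ 4 ≤ 100 * C / (p ^ 12 * m) := by
      calc C * m ^ 3 * h ^ 4 ≤ C * m ^ 3 * (100 / n ^ 4) := by gcongr
        _ = 100 * C / (p ^ 12 * m) := by
          rw [hnr, mul_pow, ← pow_mul]
          field_simp
    calc _ ≤ _ := abs_add_le _ _
      _ ≤ 100 * C / (p ^ 12 * m) + 16 * ((C + 1) / (p ^ 12 * m)) := by linarith
      _ = K / (p ^ 12 * m) := by
        rw [hK]
        ring
  · intro P hP hfP
    obtain ⟨P₁, hP₁, hPd⟩ := exists_deriv_mem_trigSpan hP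
    have hPg : ∀ x, |P x - g x| ≤ (A + 1) * K / (p ^ 12 * m) := by
      intro x
      have h1 : (C + 1) / (p ^ 12 * m) ≤ K / (p ^ 12 * m) := by
        gcongr
        linarith
      calc |P x - g x| = |-(f x - P x) + (f x - g x)| := by ring_nf
        _ ≤ |-(f x - P x)| + |f x - g x| := abs_add_le _ _
        _ ≤ A * (K / (p ^ 12 * m)) + K / (p ^ 12 * m) := by
          rw [abs_neg]
          exact add_le_add (hfP x) ((hfg x).trans h1)
        _ = _ := by ring
    have hbern := bernstein_inequality (n := n) (by omega)
      (sub_mem hP (trigSpan_freq_mono (by omega) hgmem)) (fun x => (hPd x).sub (hgd x)) hPg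
    have hbound : 2 * n * ((A + 1) * K / (p ^ 12 * m)) < τ / (2 * q) := by
      rw [hnr, hqp]
      have : 2 * (p ^ 3 * m) * ((A + 1) * K / (p ^ 12 * m)) = 4 * (A + 1) * K / (2 * p ^ 8 * p) := by
        field_simp
        ring
      rw [this, div_lt_div_iff₀ (by positivity) (by positivity)]
      have h8 : (0 : ℝ) < 2 * p ^ 8 := by positivity
      nlinarith [mul_lt_mul_of_pos_right hpτ h8]
    have hsub : {x : ℝ | x ∈ Set.Icc x₀ (x₀ + l) ∧ ∃ j : ℤ, |m * x - 2 * Real.pi * j| ≤ r} ⊆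
        {x | x ∈ Set.Ioo a b ∧ deriv P x < 0} := by
      rintro x ⟨hx, j, hj⟩
      obtain ⟨hxab, hxτ⟩ := hJ x hx
      refine ⟨hxab, ?_⟩
      rw [(hPd x).deriv]
      have hq3 : 0 < 1 / (2 * (q : ℝ)) := by positivity
      have h5 : (rieszMean q - Real.cos (m * x)) / rieszMean q ≤ -(1 / (2 * q)) := by
        refine riesz_main_part_le (by omega) (j := j) ?_
        rw [← hrq]
        exact sq_le_sq' (abs_le.1 hj).1 (abs_le.1 hj).2
      have h6 : F₁ x * ((rieszMean q - Real.cos (m * x)) / rieszMean q) ≤ -(τ / (2 * q)) := by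
        have h7 : τ * (1 / (2 * q)) ≤ F₁ x * (1 / (2 * q)) :=
          mul_le_mul_of_nonneg_right hxτ.le hq3.le
        have h8 := mul_le_mul_of_nonneg_left h5 (hτ0.trans hxτ).le
        have h9 : τ / (2 * q) = τ * (1 / (2 * q)) := by ring
        linarith
      linarith [(abs_le.1 (hbern x)).2]
    refine lt_of_lt_of_le ?_ ((volume_near_grid_ge hl hr0 hr1 hml).trans (measure_mono hsub))
    exact (ENNReal.ofReal_lt_ofReal_iff (by positivity)).2 (hN₁ n (by omega))

/-! ### The equidistant nodes and the limit function -/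

theorem exists_limit_of_geometric {F : ℕ → ℝ → ℝ} {η : ℕ → ℝ} (hpos : ∀ k, 0 < η k)
    (hη : ∀ k, η (k + 1) ≤ η k / 2) (hF : ∀ k x, |F (k + 1) x - F k x| ≤ η k / 2)
    (hc : ∀ k, Continuous (F k)) :
    ∃ f : ℝ → ℝ, Continuous f ∧ (∀ k x, |f x - F k x| ≤ η k) ∧
      ∀ x, Tendsto (fun k => F k x) atTop (nhds (f x)) := by
  have hη0 : Tendsto η atTop (nhds 0) := by
    have hle : ∀ k, η k ≤ η 0 * (1 / 2) ^ k := by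
      intro k
      induction k with
      | zero => simp
      | succ k ih =>
        rw [pow_succ]
        linarith [hη k]
    have h2 : Tendsto (fun k : ℕ => η 0 * (1 / 2 : ℝ) ^ k) atTop (nhds (η 0 * 0)) :=
      (tendsto_pow_atTop_nhds_zero_of_lt_one (by norm_num) (by norm_num)).const_mul _
    rw [mul_zero] at h2
    exact squeeze_zero (fun k => (hpos k).le) hle h2
  have hdist : ∀ x k j, k ≤ j → |F j x - F k x| ≤ η k - η j := by
    intro x k j hkj
    induction j, hkj using Nat.le_induction with
    | base => simp
    | succ j _ ih =>
      calc |F (j + 1) x - F k x| = |(F (j + 1) x - F j x) + (F j x - F k x)| := by ring_nf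
        _ ≤ |F (j + 1) x - F j x| + |F j x - F k x| := abs_add_le _ _
        _ ≤ η k - η (j + 1) := by linarith [hF j x, hη j]
  have hcauchy : ∀ x, CauchySeq fun k => F k x := by
    intro x
    refine cauchySeq_of_le_tendsto_0' η (fun k j hkj => ?_) hη0
    rw [dist_comm, Real.dist_eq]
    linarith [hdist x k j hkj, hpos j]
  choose f hf using fun x => cauchySeq_tendsto_of_complete (hcauchy x)
  have hfF : ∀ k x, |f x - F k x| ≤ η k := by
    intro k x
    refine le_of_tendsto ((hf x).sub_const (F k x)).abs ?_
    filter_upwards [eventually_ge_atTop k] with j hj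
    linarith [hdist x k j hj, hpos j]
  refine ⟨f, ?_, hfF, hf⟩
  have hunif : TendstoUniformly F f atTop := by
    rw [Metric.tendstoUniformly_iff]
    intro e he
    filter_upwards [hη0.eventually (gt_mem_nhds he)] with k hk x
    exact (hfF k x).trans_lt hk
  exact hunif.continuous (Eventually.of_forall hc).frequently

/-- The equidistant nodes. -/
noncomputable def equiNode (s : ℕ) (i : ℤ) : ℝ :=
  Real.pi + Real.pi / (2 * (s : ℝ)) - (i : ℝ) * (Real.pi / (s : ℝ))

theorem isNodes_equiNode {s : ℕ} (hs : 1 ≤ s) : IsNodes s (equiNode s) := by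
  have hs0 : (0 : ℝ) < s := by exact_mod_cast hs
  have hpi := Real.pi_pos
  have hstep : 0 < Real.pi / s := by positivity
  have hhalf : Real.pi / (2 * (s : ℝ)) = Real.pi / s / 2 := by field_simp
  have htot : (2 * s : ℝ) * (Real.pi / s) = 2 * Real.pi := by field_simp
  refine ⟨?_, ?_, fun i j _ hij _ => ?_, fun i => ?_⟩
  · simp only [equiNode]
    push_cast
    rw [hhalf, htot]
    linarith
  · simp only [equiNode]
    push_cast
    rw [hhalf]
    linarith
  · have : (i : ℝ) < j := by exact_mod_cast hij
    simp only [equiNode]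
    nlinarith
  · simp only [equiNode]
    push_cast
    rw [add_mul, htot]
    ring

/-- The sign pattern of the class `Δ^{(1)}(Y_s)` for the equidistant nodes is that of this
function. -/
noncomputable def signPattern (s : ℕ) (x : ℝ) : ℝ := Real.cos (s * x - s * Real.pi)

theorem sin_mul_sub_equiNode_nonneg {s : ℕ} (hs : 1 ≤ s) {i : ℤ} {x : ℝ}
    (hx : x ∈ Set.Icc (equiNode s i) (equiNode s (i - 1))) :
    0 ≤ Real.sin (s * (x - equiNode s i)) := by
  have hs0 : (0 : ℝ) < s := by exact_mod_cast hs
  have h1 : equiNode s (i - 1) = equiNode s i + Real.pi / s := by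
    simp only [equiNode]
    push_cast
    ring
  refine Real.sin_nonneg_of_nonneg_of_le_pi (mul_nonneg hs0.le (by linarith [hx.1])) ?_
  calc s * (x - equiNode s i) ≤ s * (Real.pi / s) :=
        mul_le_mul_of_nonneg_left (by linarith [hx.2]) hs0.le
    _ = Real.pi := by field_simp

theorem signPattern_nonneg {s : ℕ} (hs : 1 ≤ s) {i : ℤ} (hi : Odd i) {x : ℝ}
    (hx : x ∈ Set.Icc (equiNode s i) (equiNode s (i - 1))) : 0 ≤ signPattern s x := by
  obtain ⟨k, hk⟩ := hi
  have hs0 : (s : ℝ) ≠ 0 := by exact_mod_cast (by omega : s ≠ 0)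
  have h1 : s * x - s * Real.pi =
      s * (x - equiNode s i) - Real.pi / 2 - k * (2 * Real.pi) := by
    rw [hk, equiNode]
    push_cast
    field_simp
    ring
  rw [signPattern, h1, Real.cos_sub_int_mul_two_pi, Real.cos_sub_pi_div_two]
  exact sin_mul_sub_equiNode_nonneg hs hx

theorem signPattern_nonpos {s : ℕ} (hs : 1 ≤ s) {i : ℤ} (hi : Even i) {x : ℝ}
    (hx : x ∈ Set.Icc (equiNode s i) (equiNode s (i - 1))) : signPattern s x ≤ 0 := by
  obtain ⟨k, hk⟩ := hi
  have hs0 : (s : ℝ) ≠ 0 := by exact_mod_cast (by omega : s ≠ 0)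
  have h1 : s * x - s * Real.pi =
      s * (x - equiNode s i) + Real.pi / 2 - k * (2 * Real.pi) := by
    rw [hk, equiNode]
    push_cast
    field_simp
    ring
  rw [signPattern, h1, Real.cos_sub_int_mul_two_pi, Real.cos_add_pi_div_two]
  linarith [sin_mul_sub_equiNode_nonneg hs hx]

theorem monotoneOn_of_mul_signPattern {s : ℕ} (hs : 1 ≤ s) {F F₁ : ℝ → ℝ}
    (hF : ∀ x, HasDerivAt F (F₁ x) x) (hsign : ∀ x, ∃ c ≥ 0, F₁ x = c * signPattern s x)
    {i : ℤ} (hi : Odd i) : MonotoneOn F (Set.Icc (equiNode s i) (equiNode s (i - 1))) := by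
  refine monotoneOn_of_deriv_nonneg (convex_Icc _ _)
    (fun x _ => (hF x).continuousAt.continuousWithinAt)
    (fun x _ => (hF x).differentiableAt.differentiableWithinAt) fun x hx => ?_
  obtain ⟨c, hc, h⟩ := hsign x
  rw [(hF x).deriv, h]
  exact mul_nonneg hc (signPattern_nonneg hs hi (interior_subset hx))

theorem antitoneOn_of_mul_signPattern {s : ℕ} (hs : 1 ≤ s) {F F₁ : ℝ → ℝ}
    (hF : ∀ x, HasDerivAt F (F₁ x) x) (hsign : ∀ x, ∃ c ≥ 0, F₁ x = c * signPattern s x)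
    {i : ℤ} (hi : Even i) : AntitoneOn F (Set.Icc (equiNode s i) (equiNode s (i - 1))) := by
  refine antitoneOn_of_deriv_nonpos (convex_Icc _ _)
    (fun x _ => (hF x).continuousAt.continuousWithinAt)
    (fun x _ => (hF x).differentiableAt.differentiableWithinAt) fun x hx => ?_
  obtain ⟨c, hc, h⟩ := hsign x
  rw [(hF x).deriv, h]
  exact mul_nonpos_of_nonneg_of_nonpos hc (signPattern_nonpos hs hi (interior_subset hx))

theorem nodeProd_equiNode_pos {s : ℕ} (hs : 1 ≤ s) {x : ℝ}
    (hx : x ∈ Set.Ioo (Real.pi - Real.pi / (2 * s)) Real.pi) : 0 < nodeProd s (equiNode s) x := by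
  have hs0 : (0 : ℝ) < s := by exact_mod_cast hs
  have hpi := Real.pi_pos
  have hstep : 0 < Real.pi / s := by positivity
  have hhalf : Real.pi / (2 * (s : ℝ)) = Real.pi / s / 2 := by field_simp
  have htot : (2 * s : ℝ) * (Real.pi / s) = 2 * Real.pi := by field_simp
  refine Finset.prod_pos fun i hi => ?_
  obtain ⟨hi1, hi2⟩ := Finset.mem_Icc.1 hi
  have hi1' : (1 : ℝ) ≤ i := by exact_mod_cast hi1
  have hi2' : (i : ℝ) ≤ 2 * s := by exact_mod_cast hi2
  have h1 := mul_le_mul_of_nonneg_right hi1' hstep.le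
  have h2 := mul_le_mul_of_nonneg_right hi2' hstep.le
  have hx1 := hx.1
  rw [hhalf] at hx1
  refine Real.sin_pos_of_pos_of_lt_pi ?_ ?_ <;> rw [equiNode, hhalf] <;> linarith [hx.2]

/-- A trigonometric polynomial `F` with derivative `F₁` that follows the sign pattern, with the
radius of the uniform ball around it within which the later stages of the construction stay.
Positivity of `F₁` is only recorded in an interval on which `nodeProd` is positive. -/
structure Stage (s : ℕ) where
  deg : ℕ
  F : ℝ → ℝ
  F₁ : ℝ → ℝ
  mem : F ∈ trigSpan (freq deg)
  hasDerivAt : ∀ x, HasDerivAt F (F₁ x) x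
  sign : ∀ x, ∃ c ≥ 0, F₁ x = c * signPattern s x
  exists_pos : ∃ x ∈ Set.Ioo (Real.pi - Real.pi / (2 * s)) Real.pi, 0 < F₁ x
  radius : ℝ
  radius_pos : 0 < radius

/-- The first stage is `sin (s (x - π))`. -/
theorem exists_first_stage {s : ℕ} (hs : 1 ≤ s) :
    ∃ S : Stage s, (∀ x, S.F x = Real.sin (s * x - s * Real.pi)) ∧ S.radius = 1 / 4 := by
  have hs0 : (0 : ℝ) < s := by exact_mod_cast hs
  have hpi := Real.pi_pos
  refine ⟨⟨s, fun x => Real.sin (s * x - s * Real.pi), fun x => s * signPattern s x, ?_, ?_,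
    fun x => ⟨s, hs0.le, rfl⟩, ⟨Real.pi - Real.pi / s / 4, ⟨?_, ?_⟩, ?_⟩, 1 / 4, by norm_num⟩,
    fun x => rfl, rfl⟩
  · have hmem : ((s : ℕ) : ℤ) ∈ freq s := by simp [freq]
    have := sub_mem
      ((trigSpan (freq s)).smul_mem (Real.cos (s * Real.pi)) (sin_mem_trigSpan hmem))
      ((trigSpan (freq s)).smul_mem (Real.sin (s * Real.pi)) (cos_mem_trigSpan hmem))
    convert this using 1
    ext x
    simp only [Pi.sub_apply, Pi.smul_apply, smul_eq_mul, Real.sin_sub, Int.cast_natCast]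
    ring
  · intro x
    refine (((hasDerivAt_id x).const_mul (s : ℝ)).sub_const (s * Real.pi)).sin.congr_deriv ?_
    simp only [signPattern, id]
    ring
  · have : Real.pi / (2 * (s : ℝ)) = Real.pi / s / 2 := by field_simp
    rw [this]
    linarith [div_pos hpi hs0]
  · linarith [div_pos hpi hs0]
  · refine mul_pos hs0 ?_
    have : s * (Real.pi - Real.pi / s / 4) - s * Real.pi = -(Real.pi / 4) := by
      field_simp
      ring
    rw [signPattern, this, Real.cos_neg]
    refine Real.cos_pos_of_mem_Ioo ⟨by linarith, by linarith⟩

/-- All functions in the ball around the new stage are hard to approximate for one degree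
`n ≥ k`, by the factor `k`. -/
theorem exists_next_stage {s : ℕ} {ε : ℕ → ℝ} (hε : Tendsto ε atTop (nhds 0)) (k : ℕ)
    (S : Stage s) :
    ∃ T : Stage s, (∀ x, |T.F x - S.F x| ≤ S.radius / 2) ∧ T.radius ≤ S.radius / 2 ∧
      ∃ n ≥ k, ∃ Ω > 0, ∀ f : ℝ → ℝ, (∀ x, |f x - T.F x| ≤ T.radius) →
        modulus 4 f (Real.pi / n) ≤ Ω ∧ ∀ P ∈ trigSpan (freq n), (∀ x, |f x - P x| ≤ k * Ω) →
          ENNReal.ofReal (ε n) <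
            volume {x | x ∈ Set.Ioo (Real.pi - Real.pi / (2 * s)) Real.pi ∧ deriv P x < 0} := by
  obtain ⟨x₀, hx₀, hpos⟩ := S.exists_pos
  obtain ⟨d, Φ, Φ₁, hmem, hd, hsign, hex, hclose, η, hη, n, hn, Ω, hΩ, h⟩ :=
    exists_perturbation S.mem S.hasDerivAt hx₀ hpos hε (Nat.cast_nonneg k) k
      (half_pos S.radius_pos)
  refine ⟨⟨d, Φ, Φ₁, hmem, hd, fun x => ?_, hex, min η (S.radius / 2),
    lt_min hη (half_pos S.radius_pos)⟩, hclose, min_le_right _ _, n, hn, Ω, hΩ,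
    fun f hf => h f fun x => (hf x).trans (min_le_left _ _)⟩
  obtain ⟨c, hc, h1⟩ := hsign x
  obtain ⟨c', hc', h2⟩ := S.sign x
  exact ⟨c * c', mul_nonneg hc hc', by rw [h1, h2, mul_assoc]⟩

/-- The limit of the stages: for infinitely many `n`, every polynomial of degree `n` that approximates
it within `k` times its modulus of smoothness violates the sign pattern on a set of measure greater
than `ε n`. -/
theorem exists_bad_function {s : ℕ} (hs : 1 ≤ s) {ε : ℕ → ℝ} (hε : Tendsto ε atTop (nhds 0)) :
    ∃ f : ℝ → ℝ, IsPiecewiseMonotone (equiNode s) f ∧ (∃ x₀ x₁, f x₀ ≠ f x₁) ∧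
      ∀ k : ℕ, ∃ n ≥ k, ∃ Ω > 0, modulus 4 f (Real.pi / n) ≤ Ω ∧
        ∀ P ∈ trigSpan (freq n), (∀ x, |f x - P x| ≤ k * Ω) → ENNReal.ofReal (ε n) <
          volume {x | x ∈ Set.Ioo (Real.pi - Real.pi / (2 * s)) Real.pi ∧ deriv P x < 0} := by
  obtain ⟨S₀, hS₀, hr₀⟩ := exists_first_stage hs
  choose next hnext using exists_next_stage (s := s) hε
  let S : ℕ → Stage s := fun k => Nat.rec S₀ (fun k T => next k T) k
  obtain ⟨f, hfc, hf, hlim⟩ := exists_limit_of_geometric (F := fun k => (S k).F)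
    (fun k => (S k).radius_pos) (fun k => (hnext k (S k)).2.1) (fun k => (hnext k (S k)).1)
    fun k => continuous_iff_continuousAt.2 fun x => ((S k).hasDerivAt x).continuousAt
  have hs0 : (s : ℝ) ≠ 0 := by exact_mod_cast (by omega : s ≠ 0)
  have hf0 : ∀ x, |f x - Real.sin (s * x - s * Real.pi)| ≤ 1 / 4 := fun x => by
    rw [← hS₀, ← hr₀]
    exact hf 0 x
  refine ⟨f, ⟨hfc, fun x => ?_, fun i hi x hx y hy hxy => ?_, fun i hi x hx y hy hxy => ?_⟩,
    ⟨Real.pi + Real.pi / (2 * s), Real.pi - Real.pi / (2 * s), ?_⟩, fun k => ?_⟩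
  · refine tendsto_nhds_unique (hlim (x + 2 * Real.pi)) ((hlim x).congr fun k => ?_)
    exact (periodic_of_mem_trigSpan (S k).mem x).symm
  · exact le_of_tendsto_of_tendsto' (hlim x) (hlim y) fun k =>
      monotoneOn_of_mul_signPattern hs (S k).hasDerivAt (S k).sign hi hx hy hxy
  · exact le_of_tendsto_of_tendsto' (hlim y) (hlim x) fun k =>
      antitoneOn_of_mul_signPattern hs (S k).hasDerivAt (S k).sign hi hx hy hxy
  · have h1 : |f (Real.pi + Real.pi / (2 * s)) - 1| ≤ 1 / 4 := by
      have h : s * (Real.pi + Real.pi / (2 * s)) - s * Real.pi = Real.pi / 2 := by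
        field_simp
        ring
      have := hf0 (Real.pi + Real.pi / (2 * s))
      rwa [h, Real.sin_pi_div_two] at this
    have h2 : |f (Real.pi - Real.pi / (2 * s)) - -1| ≤ 1 / 4 := by
      have h : s * (Real.pi - Real.pi / (2 * s)) - s * Real.pi = -(Real.pi / 2) := by
        field_simp
        ring
      have := hf0 (Real.pi - Real.pi / (2 * s))
      rwa [h, Real.sin_neg, Real.sin_pi_div_two] at this
    intro h
    rw [h] at h1
    linarith [(abs_le.1 h1).1, (abs_le.1 h2).2]
  · obtain ⟨-, -, n, hn, Ω, hΩ, h⟩ := hnext k (S k)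
    exact ⟨n, hn, Ω, hΩ, h f (hf (k + 1))⟩

/-! ### Lower bounds for the error of nearly comonotone approximation -/

theorem exists_abs_le_of_periodic {f : ℝ → ℝ} (hf : Continuous f)
    (hper : Function.Periodic f (2 * Real.pi)) : ∃ M, ∀ x, |f x| ≤ M := by
  obtain ⟨M, hM⟩ := isCompact_Icc.exists_bound_of_continuousOn
    (s := Set.Icc 0 (2 * Real.pi)) hf.continuousOn
  refine ⟨M, fun x => ?_⟩
  obtain ⟨y, hy, hxy⟩ := hper.exists_mem_Ico₀ Real.two_pi_pos x
  rw [hxy]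
  exact hM y ⟨hy.1, hy.2.le⟩

theorem not_nearlyComonotone {s : ℕ} (hs : 1 ≤ s) {n : ℕ} {ε : ℝ} {P : ℝ → ℝ}
    (hP : ENNReal.ofReal ε <
      volume {x | x ∈ Set.Ioo (Real.pi - Real.pi / (2 * s)) Real.pi ∧ deriv P x < 0}) :
    ¬ NearlyComonotone s (equiNode s) n ε P := by
  rintro ⟨-, hgood⟩
  have hpi := Real.pi_pos
  set B : Set ℝ := {x | x ∈ Set.Ioo (Real.pi - Real.pi / (2 * s)) Real.pi ∧ deriv P x < 0} with hB
  have hBmeas : MeasurableSet B :=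
    measurableSet_Ioo.inter (measurableSet_lt (measurable_deriv P) measurable_const)
  have hdisj : Disjoint
      ({x : ℝ | 0 ≤ deriv P x * nodeProd s (equiNode s) x} ∩ Set.Icc (-Real.pi) Real.pi) B := by
    rw [Set.disjoint_left]
    rintro x ⟨hx, -⟩ ⟨hx1, hx2⟩
    exact (mul_neg_of_neg_of_pos hx2 (nodeProd_equiNode_pos hs hx1)).not_ge hx
  have hsub : ({x : ℝ | 0 ≤ deriv P x * nodeProd s (equiNode s) x} ∩
      Set.Icc (-Real.pi) Real.pi) ∪ B ⊆ Set.Icc (-Real.pi) Real.pi := by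
    refine Set.union_subset Set.inter_subset_right ?_
    rintro x ⟨⟨hx1, hx2⟩, -⟩
    have hs1 : (1 : ℝ) ≤ s := by exact_mod_cast hs
    have : Real.pi / (2 * s) ≤ Real.pi := div_le_self hpi.le (by linarith)
    exact ⟨by linarith, hx2.le⟩
  have h1 := measure_mono (μ := volume) hsub
  rw [measure_union hdisj hBmeas, Real.volume_Icc] at h1
  have h2 : ENNReal.ofReal (2 * Real.pi - ε) + ENNReal.ofReal ε < ENNReal.ofReal (2 * Real.pi) := by
    refine lt_of_lt_of_le ?_ ((add_le_add hgood le_rfl).trans (h1.trans_eq ?_))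
    · exact ENNReal.add_lt_add_left ENNReal.ofReal_ne_top hP
    · congr 1
      ring
  refine h2.not_ge ?_
  calc ENNReal.ofReal (2 * Real.pi) = ENNReal.ofReal (2 * Real.pi - ε + ε) := by
        rw [sub_add_cancel]
    _ ≤ _ := ENNReal.ofReal_add_le

theorem le_nearlyComonotoneError {s : ℕ} (hs : 1 ≤ s) {n : ℕ} {ε : ℝ} (hε : 0 ≤ ε) {f : ℝ → ℝ}
    {M : ℝ} (hM : ∀ x, |f x| ≤ M) {c : ℝ}
    (hc : ∀ P ∈ trigSpan (freq n), (∀ x, |f x - P x| ≤ c) → ENNReal.ofReal ε <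
      volume {x | x ∈ Set.Ioo (Real.pi - Real.pi / (2 * s)) Real.pi ∧ deriv P x < 0}) :
    c ≤ nearlyComonotoneError s (equiNode s) n ε f := by
  refine le_csInf ?_ ?_
  · refine ⟨_, 0, ⟨⟨0, 0, by simp⟩, ?_⟩, rfl⟩
    have h1 : {x : ℝ | 0 ≤ deriv (0 : ℝ → ℝ) x * nodeProd s (equiNode s) x} = Set.univ := by
      ext x
      simp
    rw [h1, Set.univ_inter, Real.volume_Icc]
    exact ENNReal.ofReal_le_ofReal (by linarith)
  · rintro _ ⟨P, hP, rfl⟩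
    by_contra hlt
    push Not at hlt
    have hmem := hP.1.mem_trigSpan
    obtain ⟨M', hM'⟩ := exists_bound_of_mem_trigSpan hmem
    have hbdd : BddAbove (Set.range fun x => |f x - P x|) := by
      refine ⟨M + M', ?_⟩
      rintro _ ⟨x, rfl⟩
      exact (abs_sub _ _).trans (add_le_add (hM x) (hM' x))
    exact not_nearlyComonotone hs
      (hc P hmem fun x => (le_ciSup hbdd x).trans hlt.le) hP

end Comonotone

theorem theorem1 (s : ℕ) (hs : 1 ≤ s) (ε : ℕ → ℝ) (hε : ∀ n : ℕ, 1 ≤ n → 0 ≤ ε n)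
    (hlim : Filter.Tendsto ε Filter.atTop (nhds 0)) :
    ∃ y : ℤ → ℝ, Comonotone.IsNodes s y ∧
      (∀ i : ℤ, y i = Real.pi + Real.pi / (2 * (s : ℝ)) - (i : ℝ) * (Real.pi / (s : ℝ))) ∧
      ∃ f : ℝ → ℝ, Comonotone.IsPiecewiseMonotone y f ∧
        Filter.limsup
          (fun n : ℕ =>
            ((Comonotone.nearlyComonotoneError s y n (ε n) f /
              Comonotone.modulus 4 f (Real.pi / (n : ℝ)) : ℝ) : EReal))
          Filter.atTop = ⊤ := by
  obtain ⟨f, hf, ⟨x₀, x₁, hne⟩, hbad⟩ := Comonotone.exists_bad_function hs hlim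
  obtain ⟨M, hM⟩ := Comonotone.exists_abs_le_of_periodic hf.continuous hf.periodic
  refine ⟨Comonotone.equiNode s, Comonotone.isNodes_equiNode hs, fun i => rfl, f, hf, ?_⟩
  refine EReal.eq_top_iff_forall_lt _ |>.2 fun A => ?_
  refine lt_of_lt_of_le (EReal.coe_lt_coe_iff.2 (lt_add_one A)) ?_
  refine le_limsup_of_frequently_le (frequently_atTop.2 fun N => ?_)
  obtain ⟨k, hk⟩ := exists_nat_ge (max (max (N : ℝ) 1) (A + 1))
  have hkN : N ≤ k := by
    exact_mod_cast ((le_max_left _ _).trans (le_max_left _ _)).trans hk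
  have hk1 : 1 ≤ k := by
    exact_mod_cast ((le_max_right _ _).trans (le_max_left _ _)).trans hk
  have hkA : A + 1 ≤ k := (le_max_right _ _).trans hk
  obtain ⟨n, hn, Ω, hΩ, hmod, hP⟩ := hbad k
  refine ⟨n, hkN.trans hn, EReal.coe_le_coe_iff.2 ?_⟩
  have hn0 : (0 : ℝ) < n := by exact_mod_cast (by omega : 0 < n)
  have hpos := Comonotone.modulus_four_pos hf.continuous hf.periodic hM hne
    (div_pos Real.pi_pos hn0)
  rw [le_div_iff₀ hpos]
  calc (A + 1) * Comonotone.modulus 4 f (Real.pi / n)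
      ≤ k * Comonotone.modulus 4 f (Real.pi / n) := mul_le_mul_of_nonneg_right hkA hpos.le
    _ ≤ k * Ω := mul_le_mul_of_nonneg_left hmod (Nat.cast_nonneg k)
    _ ≤ _ := Comonotone.le_nearlyComonotoneError hs (hε n (hk1.trans hn)) hM hP
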